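/- Let $M,n\ge 0$ be integers and $K=M+2n$. For $1\le a\le K$ put $[a]=0$ if $a\le M$ and $[a]=1$ if $a>M$. The super Yangian $Y(M|2n)$ is the associative $\mathbb C$-algebra (graded by $\mathbb Z/2$) with generators $T^{ab}_{(p)}$ ($1\le a,b\le K$, $p\ge 1$) of degree $[a]+[b]$ and relations, in terms of the series $T^{ab}(u)=\delta_{ab}+\sum_{p\ge1}T^{ab}_{(p)}u^{-p}$, $$(u-v)\Bigl(T^{ab}(u)T^{cd}(v)-(-1)^{([a]+[b])([c]+[d])}T^{cd}(v)T^{ab}(u)\Bigr)=(-1)^{[a][b]+([a]+[b])[c]}\Bigl(T^{cb}(u)T^{ad}(v)-T^{cb}(v)T^{ad}(u)\Bigr).$$ Put $\bar a=M+1-a$ for $a\le M$ and $\bar a=2M+2n+1-a$ for $a>M$; put $\theta_a=1$ for $a\le M+n$ and $\theta_a=-1$ for $a>M+n$. The twisted super Yangian $Y(M|2n)^+$ is the subalgebra of $Y(M|2n)$ generated by the coefficients of the series $$S^{ab}(u)=\sum_{p\ge0}S^{ab}_{(p)}u^{-p}=\sum_{c=1}^{K}(-1)^{[c]([b]+1)}\theta_c\theta_b\,T^{ac}(u)\,T^{\bar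 b\bar c}(-u),\qquad 1\le a,b\le K.$$ Let $\Phi^+$ be the set of pairs $(a,b)$ such that one of the following holds: $1\le a<b\le M$; $M+1\le a<b\le M+2n$; $1\le a\le M$ and $M+n+1\le b\le M+2n$; $M+1\le a\le M+n$ and $1\le b\le M$. A nonzero vector $v$ of a $Y(M|2n)^+$-module is called a highest weight vector if $S^{ab}(u)v=0$ for all $(a,b)\in\Phi^+$ and, for every $a=1,\dots,K$, $S^{aa}(u)v=\mu_a(u)v$ for some formal series $\mu_a(u)\in 1+u^{-1}\mathbb C[[u^{-1}]]$. **Theorem.** Let $V$ be a finite-dimensional irreducible representation of $Y(M|2n)^+$ over $\mathbb C$ (irreducible either as a plain module, or as a $\mathbb Z/2$-graded module, meaning that $V\neq 0$ is $\mathbb Z/2$-graded compatibly with the action and has no graded submodules other than $0$ and $V$). Then $V$ is generated, as a $Y(M|2n)^+$-module, by a highest weight vector, and any two highest weight vectors of $V$ are proportional. -/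

import Mathlib

noncomputable section

namespace TwistedSuperYangian

/-! The indices `1, …, M + N` are represented by the elements `0, …, M + N - 1` of
`Fin (M + N)`. -/

/-- The `ℤ/2`-degree `[a]` of an index: `0` for the first `M` indices, `1` for the last `N`. -/
def deg (M : ℕ) {N : ℕ} (a : Fin (M + N)) : ℕ := if (a : ℕ) < M then 0 else 1

/-! ### The super Yangian `Y(M|N)` -/

/-- The coefficient `T^{ab}_{(p)}` in the free algebra on the letters `T^{ab}_{(p+1)}`, `p ≥ 0`;
by convention `T^{ab}_{(0)} = δ_{ab}`. -/
def freeT (M N : ℕ) (p : ℕ) (a b : Fin (M + N)) :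
    FreeAlgebra ℂ (ℕ × Fin (M + N) × Fin (M + N)) :=
  match p with
  | 0 => if a = b then 1 else 0
  | q + 1 => FreeAlgebra.ι ℂ (q, a, b)

/-- The graded commutator `[T^{ab}_{(r)}, T^{cd}_{(s)}}` in the free algebra. -/
def freeComm (M N : ℕ) (r : ℕ) (a b : Fin (M + N)) (s : ℕ) (c d : Fin (M + N)) :
    FreeAlgebra ℂ (ℕ × Fin (M + N) × Fin (M + N)) :=
  freeT M N r a b * freeT M N s c d -
    (-1 : ℂ) ^ ((deg M a + deg M b) * (deg M c + deg M d)) •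
      (freeT M N s c d * freeT M N r a b)

/-- The defining relations of `Y(M|N)`: the coefficients at `u^{-r} v^{-s}` of
`(u - v) [T^{ab}(u), T^{cd}(v)} =
  (-1)^{[a][b] + ([a]+[b])[c]} (T^{cb}(u) T^{ad}(v) - T^{cb}(v) T^{ad}(u))`,
where `T^{ab}(u) = ∑_p T^{ab}_{(p)} u^{-p}`. (The remaining coefficients, those with a positive power
of `u` or of `v`, only involve commutators with the scalars `T_{(0)}`.) -/
inductive YangianRel (M N : ℕ) :
    FreeAlgebra ℂ (ℕ × Fin (M + N) × Fin (M + N)) →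
      FreeAlgebra ℂ (ℕ × Fin (M + N) × Fin (M + N)) → Prop
  | rtt (a b c d : Fin (M + N)) (r s : ℕ) :
      YangianRel M N
        (freeComm M N (r + 1) a b s c d - freeComm M N r a b (s + 1) c d)
        ((-1 : ℂ) ^ (deg M a * deg M b + (deg M a + deg M b) * deg M c) •
          (freeT M N r c b * freeT M N s a d - freeT M N s c b * freeT M N r a d))

/-- The super Yangian `Y(M|N)` based on `gl(M|N)`, as an associative algebra. -/
abbrev SuperYangian (M N : ℕ) : Type := RingQuot (YangianRel M N)

/-- The element `T^{ab}_{(p)}` of `Y(M|N)`. -/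
def T (M N : ℕ) (p : ℕ) (a b : Fin (M + N)) : SuperYangian M N :=
  RingQuot.mkAlgHom ℂ (YangianRel M N) (freeT M N p a b)

/-! ### The twisted super Yangian `Y(M|2n)^+` -/

/-- The involution `a ↦ ā` of the indices: it reverses the first `M` and the last `N` indices
separately. -/
def bar {M N : ℕ} (a : Fin (M + N)) : Fin (M + N) :=
  if h : (a : ℕ) < M then ⟨M - 1 - a, by omega⟩
  else ⟨2 * M + N - 1 - a, by have := a.isLt; omega⟩

/-- The signs `θ_a`: `-1` for the last `n` of the `M + 2n` indices, `+1` for all the others. -/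
def theta (M n : ℕ) (a : Fin (M + 2 * n)) : ℂ := if (a : ℕ) < M + n then 1 else -1

/-- The coefficient at `u^{-p}` of
`τ(T^{ab}(u)) = (-1)^{[a]([b]+1)} θ_a θ_b T^{b̄ā}(-u)`. -/
def tauT (M n : ℕ) (p : ℕ) (a b : Fin (M + 2 * n)) : SuperYangian M (2 * n) :=
  ((-1 : ℂ) ^ (deg M a * (deg M b + 1)) * theta M n a * theta M n b * (-1 : ℂ) ^ p) •
    T M (2 * n) p (bar b) (bar a)

/-- The coefficient at `u^{-p}` of `S^{ab}(u) = ∑_c T^{ac}(u) τ(T^{cb}(u))`. -/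
def S (M n : ℕ) (p : ℕ) (a b : Fin (M + 2 * n)) : SuperYangian M (2 * n) :=
  ∑ q ∈ Finset.range (p + 1), ∑ c : Fin (M + 2 * n),
    T M (2 * n) (p - q) a c * tauT M n q c b

/-- The twisted super Yangian `Y(M|2n)^+`: the subalgebra of `Y(M|2n)` generated by the
coefficients of the series `S^{ab}(u)`. -/
abbrev TwistedYangian (M n : ℕ) : Subalgebra ℂ (SuperYangian M (2 * n)) :=
  Algebra.adjoin ℂ {x | ∃ (p : ℕ) (a b : Fin (M + 2 * n)), x = S M n p a b}

/-- The generator `S^{ab}_{(p)}` as an element of `Y(M|2n)^+`. -/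
def gen (M n : ℕ) (p : ℕ) (a b : Fin (M + 2 * n)) : TwistedYangian M n :=
  ⟨S M n p a b, Algebra.subset_adjoin ⟨p, a, b, rfl⟩⟩

/-! ### Highest weight vectors -/

/-- The positive root system `Φ⁺` (with indices counted from `0`). -/
def PositiveRoot (M n : ℕ) (a b : Fin (M + 2 * n)) : Prop :=
  (a < b ∧ (b : ℕ) < M) ∨
  (M ≤ (a : ℕ) ∧ a < b) ∨
  ((a : ℕ) < M ∧ M + n ≤ (b : ℕ)) ∨
  (M ≤ (a : ℕ) ∧ (a : ℕ) < M + n ∧ (b : ℕ) < M)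

/-- A highest weight vector: a nonzero vector `v` with `S^{ab}(u) v = 0` for all `(a, b) ∈ Φ⁺` and
`S^{aa}(u) v = μ_a(u) v` for all `a`, for some formal series `μ_a(u) ∈ 1 + u⁻¹ ℂ[[u⁻¹]]`
(the variable of the power series `μ a` stands for `u⁻¹`). -/
def IsHighestWeightVector (M n : ℕ) {V : Type*} [AddCommGroup V] [Module ℂ V]
    [Module (TwistedYangian M n) V] (v : V) : Prop :=
  v ≠ 0 ∧
  (∀ a b : Fin (M + 2 * n), PositiveRoot M n a b → ∀ p : ℕ, gen M n p a b • v = 0) ∧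
  ∃ μ : Fin (M + 2 * n) → PowerSeries ℂ,
    (∀ a, PowerSeries.constantCoeff (μ a) = 1) ∧
    ∀ a, ∀ p : ℕ, gen M n p a a • v = PowerSeries.coeff p (μ a) • v

section Modules

variable (M n : ℕ) (V : Type*) [AddCommGroup V] [Module ℂ V] [Module (TwistedYangian M n) V]

/-- A highest weight representation: one generated by a highest weight vector. -/
def IsHighestWeightRep : Prop :=
  ∃ v : V, IsHighestWeightVector M n v ∧ Submodule.span (TwistedYangian M n) {v} = ⊤

/-! ### Irreducible representations -/

/-- A `ℤ/2`-grading of the module `V`, compatible with the grading of the algebra for which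
`S^{ab}_{(p)}` has degree `[a] + [b]`. -/
structure IsSuperGrading (𝒱 : ZMod 2 → Submodule ℂ V) : Prop where
  isInternal : DirectSum.IsInternal 𝒱
  gen_smul_mem : ∀ (p : ℕ) (a b : Fin (M + 2 * n)) (i : ZMod 2) (v : V), v ∈ 𝒱 i →
    gen M n p a b • v ∈ 𝒱 (i + ((deg M a + deg M b : ℕ) : ZMod 2))

/-- Irreducibility as a `ℤ/2`-graded module: `V ≠ 0`, and the only graded submodules
(those spanned by their homogeneous elements) are `0` and `V`. -/
def IsGradedIrreducible (𝒱 : ZMod 2 → Submodule ℂ V) : Prop :=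
  Nontrivial V ∧ ∀ W : Submodule (TwistedYangian M n) V,
    (∀ w ∈ W, ∃ w₀ ∈ W, ∃ w₁ ∈ W, w₀ ∈ 𝒱 0 ∧ w₁ ∈ 𝒱 1 ∧ w = w₀ + w₁) → W = ⊥ ∨ W = ⊤

/-- Irreducible representations of `Y(M|2n)^+`, in the widest sense: either `V` is simple as a plain
module, or `V` is a `ℤ/2`-graded module without proper nonzero graded submodules. -/
def IsIrreducibleRep : Prop :=
  IsSimpleModule (TwistedYangian M n) V ∨
    ∃ 𝒱 : ZMod 2 → Submodule ℂ V, IsSuperGrading M n V 𝒱 ∧ IsGradedIrreducible M n V 𝒱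

end Modules

end TwistedSuperYangian

end

/-! The relations of the super Yangian are assembled into an RTT matrix equation, and the product of
T(u) with the transpose of T(-u) then satisfies a reflection equation (`OspIndex.reflection_matrix`,
`CoeffRTT.satisfiesReflection`). The RTT relation at v = -u also expresses each diagonal series
through its image under bar (`CoeffRTT.twist_symm`). A height function, odd under bar, turns Φ⁺ into
a total order on the indices. A combination H of the S^{aa}_{(1)} satisfies [H, S^{ab}_{(p)}] = 2(ht
a - ht b) S^{ab}_{(p)}. Only these facts are used afterwards.

Existence (`exists_isHighest`): raising operators shift H-eigenvalues by positive integers, so they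
kill an eigenspace of H whose eigenvalue has maximal real part. There the reflection equation makes
the S^{aa} with ht a ≤ 0 commute, which gives a common eigenvector; the symmetry relation supplies
the other S^{aa}.

Uniqueness (`IsHighest.mem_span`): generators commute up to sign modulo terms of lower filtration
degree, so monomials of nonnegative weight send a highest vector v into ℂv
(`IsHighest.mon_mem_span`). If v generates V, then V is ℂv plus H-eigenspaces of lower weight. Two
generating highest vectors thus have equal weights and are proportional.

In a graded irreducible module, nonzero homogeneous components of a highest vector are again highest
and each generates V. By uniqueness they are proportional, so only one occurs and the highest vector
itself generates V. -/

/-- Parities, an involution and signs of orthosymplectic type on an index set. -/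
structure OspIndex (I 𝕜 : Type*) [CommRing 𝕜] where
  deg : I → ℕ
  bar : I → I
  θ : I → 𝕜
  deg_cases : ∀ a, deg a = 0 ∨ deg a = 1
  bar_bar : ∀ a, bar (bar a) = a
  deg_bar : ∀ a, deg (bar a) = deg a
  θ_mul_self : ∀ a, θ a * θ a = 1
  θ_bar : ∀ a, θ (bar a) = (-1) ^ deg a * θ a

/-! ### Matrix form of the RTT relation and of the reflection equation. -/

namespace OspIndex

section Matrices

variable {I 𝕜 R : Type*} [Fintype I] [DecidableEq I] [CommRing 𝕜] [Ring R] [Algebra 𝕜 R]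
  (D : OspIndex I 𝕜)

/-- The super RTT relation between two families of elements, at the points `s⁻¹`, `t⁻¹`. -/
def RTT (s t : 𝕜) (A B : I → I → R) : Prop := ∀ a b c d,
  (t - s) • (A a b * B c d -
    ((-1 : 𝕜) ^ ((D.deg a + D.deg b) * (D.deg c + D.deg d))) • (B c d * A a b)) =
  (s * t * (-1 : 𝕜) ^ (D.deg a * D.deg b + (D.deg a + D.deg b) * D.deg c)) •
    (A c b * B a d - B c b * A a d)

/-- The orthosymplectic transposition of a family of elements. -/
def transp (A : I → I → R) (a b : I) : R :=
  ((-1 : 𝕜) ^ (D.deg a * (D.deg b + 1)) * D.θ a * D.θ b) • A (D.bar b) (D.bar a)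

/-- The matrix `A ⊗ 1`. -/
def leg1 (A : I → I → R) : Matrix (I × I) (I × I) R :=
  Matrix.of fun i j => if i.2 = j.2 then A i.1 j.1 else 0

/-- The matrix `1 ⊗ B`, with the signs of the super tensor product. -/
def leg2 (B : I → I → R) : Matrix (I × I) (I × I) R :=
  Matrix.of fun i j => if i.1 = j.1 then
    ((-1 : 𝕜) ^ (D.deg i.1 * (D.deg i.2 + D.deg j.2))) • B i.2 j.2 else 0

/-- The graded permutation. -/
def perm (R : Type*) [Ring R] [Algebra 𝕜 R] : Matrix (I × I) (I × I) R :=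
  Matrix.of fun i j => if j = i.swap then algebraMap 𝕜 R ((-1) ^ (D.deg i.1 * D.deg i.2)) else 0

/-- The partial orthosymplectic transpose of the graded permutation. -/
def contr (R : Type*) [Ring R] [Algebra 𝕜 R] : Matrix (I × I) (I × I) R :=
  Matrix.of fun i j => if i.2 = D.bar i.1 ∧ j.2 = D.bar j.1 then
    algebraMap 𝕜 R ((-1) ^ D.deg j.1 * D.θ i.1 * D.θ j.1) else 0

theorem perm_mul (X : Matrix (I × I) (I × I) R) (a c : I) (j : I × I) :
    (D.perm R * X) (a, c) j = ((-1 : 𝕜) ^ (D.deg a * D.deg c)) • X (c, a) j := by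
  simp [perm, Matrix.mul_apply, ite_mul, Algebra.smul_def]

theorem mul_perm (X : Matrix (I × I) (I × I) R) (i : I × I) (b d : I) :
    (X * D.perm R) i (b, d) = ((-1 : 𝕜) ^ (D.deg b * D.deg d)) • X i (d, b) := by
  rw [Matrix.mul_apply, Finset.sum_eq_single (d, b)]
  · simp only [perm, Matrix.of_apply, Prod.swap_prod_mk, if_true, mul_comm (D.deg b)]
    rw [← Algebra.commutes, Algebra.smul_def]
  · rintro ⟨e, f⟩ - h
    have : ¬ (b, d) = (f, e) := fun h' => h (by simp_all)
    simp [perm, this]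
  · simp

theorem leg1_mul_leg2 (A B : I → I → R) (a b c d : I) :
    (leg1 A * D.leg2 B) (a, c) (b, d) =
      ((-1 : 𝕜) ^ (D.deg b * (D.deg c + D.deg d))) • (A a b * B c d) := by
  simp [leg1, leg2, Matrix.mul_apply, Fintype.sum_prod_type, ite_mul, mul_ite,
    Finset.sum_ite_eq, Finset.sum_ite_eq']

theorem leg2_mul_leg1 (A B : I → I → R) (a b c d : I) :
    (D.leg2 B * leg1 A) (a, c) (b, d) =
      ((-1 : 𝕜) ^ (D.deg a * (D.deg c + D.deg d))) • (B c d * A a b) := by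
  simp [leg1, leg2, Matrix.mul_apply, Fintype.sum_prod_type, ite_mul, mul_ite,
    Finset.sum_ite_eq, Finset.sum_ite_eq']

theorem leg1_mul_contr (A : I → I → R) (a c : I) (j : I × I) :
    (leg1 A * D.contr R) (a, c) j = if j.2 = D.bar j.1 then
      ((-1 : 𝕜) ^ D.deg j.1 * D.θ (D.bar c) * D.θ j.1) • A a (D.bar c) else 0 := by
  rw [Matrix.mul_apply, Finset.sum_eq_single (D.bar c, c)]
  · simp only [leg1, contr, Matrix.of_apply, D.bar_bar, mul_ite, mul_zero, true_and, if_true]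
    rw [← Algebra.commutes, ← Algebra.smul_def]
  · rintro ⟨e, f⟩ - h
    by_cases hf : c = f
    · have : ¬ f = D.bar e := fun h' => h (by rw [hf, h', D.bar_bar])
      simp [contr, this]
    · simp [leg1, hf]
  · simp

theorem leg2_mul_contr (B : I → I → R) (a c : I) (j : I × I) :
    (D.leg2 B * D.contr R) (a, c) j = if j.2 = D.bar j.1 then
      ((-1 : 𝕜) ^ (D.deg a * (D.deg c + D.deg a)) * ((-1 : 𝕜) ^ D.deg j.1 * D.θ a * D.θ j.1)) •
        B c (D.bar a) else 0 := by
  rw [Matrix.mul_apply, Finset.sum_eq_single (a, D.bar a)]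
  · simp only [leg2, contr, Matrix.of_apply, D.deg_bar, mul_ite, mul_zero, true_and, if_true]
    split_ifs
    · rw [← Algebra.commutes, ← Algebra.smul_def, smul_smul, mul_comm]
    · rfl
  · rintro ⟨e, f⟩ - h
    by_cases hf : a = e
    · have : ¬ f = D.bar e := fun h' => h (by rw [hf, h'])
      simp [contr, this]
    · simp [leg2, hf]
  · simp

theorem leg1_contr_leg2 (A B : I → I → R) (a b c d : I) :
    (leg1 A * D.contr R * D.leg2 B) (a, c) (b, d) =
      ((-1 : 𝕜) ^ (D.deg b + D.deg b * (D.deg b + D.deg d)) * D.θ (D.bar c) * D.θ b) •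
        (A a (D.bar c) * B (D.bar b) d) := by
  rw [Matrix.mul_apply, Finset.sum_eq_single (b, D.bar b)]
  · rw [leg1_mul_contr]
    simp only [leg2, Matrix.of_apply, if_true, D.deg_bar, smul_mul_smul_comm]
    congr 1; ring
  · rintro ⟨e, f⟩ - h
    rw [leg1_mul_contr]
    by_cases hf : e = b
    · have : ¬ f = D.bar e := fun h' => h (by rw [h', hf])
      simp [this]
    · simp [leg2, hf]
  · simp

theorem leg2_contr_leg1 (A B : I → I → R) (a b c d : I) :
    (D.leg2 B * D.contr R * leg1 A) (a, c) (b, d) =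
      ((-1 : 𝕜) ^ (D.deg a * (D.deg c + D.deg a) + D.deg d) * D.θ a * D.θ (D.bar d)) •
        (B c (D.bar a) * A (D.bar d) b) := by
  rw [Matrix.mul_apply, Finset.sum_eq_single (D.bar d, d)]
  · rw [leg2_mul_contr]
    simp only [leg1, Matrix.of_apply, if_true, D.deg_bar, D.bar_bar, smul_mul_assoc]
    congr 1; ring
  · rintro ⟨e, f⟩ - h
    rw [leg2_mul_contr]
    by_cases hf : f = d
    · have : ¬ f = D.bar e := fun h' => h (by rw [hf] at *; rw [h', D.bar_bar])
      simp [this]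
    · simp [leg1, hf]
  · simp

/-- The sign (-1)^{deg a} of the graded swap on a row (a, bar a) is cancelled by `θ_bar`. This is
where the choice of orthosymplectic signs matters. -/
theorem perm_mul_contr : D.perm R * D.contr R = D.contr R := by
  ext ⟨a, c⟩ ⟨b, d⟩
  rw [perm_mul]
  simp only [contr, Matrix.of_apply]
  by_cases h : c = D.bar a
  · subst h
    simp only [D.bar_bar, D.deg_bar, true_and, D.θ_bar]
    split_ifs
    · rw [Algebra.smul_def, ← map_mul]
      congr 1
      rcases D.deg_cases a with h | h <;> simp [h]
    · simp
  · have : ¬ a = D.bar c := fun h' => h (by rw [h', D.bar_bar])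
    simp [h, this]

theorem contr_mul_perm : D.contr R * D.perm R = D.contr R := by
  ext ⟨a, c⟩ ⟨b, d⟩
  rw [mul_perm]
  simp only [contr, Matrix.of_apply]
  by_cases h : d = D.bar b
  · subst h
    simp only [D.bar_bar, D.deg_bar, and_true, D.θ_bar]
    split_ifs
    · rw [Algebra.smul_def, ← map_mul]
      congr 1
      rcases D.deg_cases b with h | h <;> simp [h]
    · simp
  · have : ¬ b = D.bar d := fun h' => h (by rw [h', D.bar_bar])
    simp [h, this]

/-- The R-matrix, multiplied by `s t`. -/
def rmat (R : Type*) [Ring R] [Algebra 𝕜 R] (s t : 𝕜) : Matrix (I × I) (I × I) R :=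
  (t - s) • (1 : Matrix (I × I) (I × I) R) - (s * t) • D.perm R

/-- The partially transposed R-matrix, multiplied by `s t`. -/
def qmat (R : Type*) [Ring R] [Algebra 𝕜 R] (s t : 𝕜) : Matrix (I × I) (I × I) R :=
  (s + t) • (1 : Matrix (I × I) (I × I) R) + (s * t) • D.contr R

/-- Both matrices are combinations of 1, P and its partial transpose K, and PK = KP = K. -/
theorem rmat_mul_qmat (s t : 𝕜) : D.rmat R s t * D.qmat R s t = D.qmat R s t * D.rmat R s t := by
  simp only [rmat, qmat, sub_mul, mul_add, mul_sub, add_mul, smul_mul_smul_comm, one_mul, mul_one,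
    perm_mul_contr, contr_mul_perm]
  module

theorem leg1_transp_contr_leg2 (A B : I → I → R) (a b c d : I) :
    (leg1 (D.transp A) * D.contr R * D.leg2 B) (a, c) (b, d) =
      ((-1 : 𝕜) ^ (D.deg b + D.deg b * (D.deg b + D.deg d) + D.deg a * (D.deg c + 1)) *
        (D.θ a * D.θ b)) • (A c (D.bar a) * B (D.bar b) d) := by
  rw [leg1_contr_leg2, transp, smul_mul_assoc, smul_smul, D.bar_bar, D.deg_bar]
  congr 1
  linear_combination ((-1 : 𝕜) ^ (D.deg b + D.deg b * (D.deg b + D.deg d)) *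
    (-1) ^ (D.deg a * (D.deg c + 1)) * D.θ a * D.θ b) * D.θ_mul_self (D.bar c)

theorem leg2_contr_leg1_transp (A B : I → I → R) (a b c d : I) :
    (D.leg2 B * D.contr R * leg1 (D.transp A)) (a, c) (b, d) =
      ((-1 : 𝕜) ^ (D.deg a * (D.deg c + D.deg a) + D.deg d + D.deg d * (D.deg b + 1)) *
        (D.θ a * D.θ b)) • (B c (D.bar a) * A (D.bar b) d) := by
  rw [leg2_contr_leg1, transp, mul_smul_comm, smul_smul, D.bar_bar, D.deg_bar]
  congr 1
  linear_combination ((-1 : 𝕜) ^ (D.deg a * (D.deg c + D.deg a) + D.deg d) *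
    (-1) ^ (D.deg d * (D.deg b + 1)) * D.θ a * D.θ b) * D.θ_mul_self (D.bar d)

theorem leg1_contr_leg2_transp (A B : I → I → R) (a b c d : I) :
    (leg1 A * D.contr R * D.leg2 (D.transp B)) (a, c) (b, d) =
      ((-1 : 𝕜) ^ (D.deg b + D.deg b * (D.deg b + D.deg d) + D.deg b * (D.deg d + 1) +
        D.deg b + D.deg c) * (D.θ c * D.θ d)) • (A a (D.bar c) * B (D.bar d) b) := by
  rw [leg1_contr_leg2, transp, mul_smul_comm, smul_smul, D.bar_bar, D.deg_bar, D.θ_bar, D.θ_bar]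
  congr 1
  linear_combination ((-1 : 𝕜) ^ (D.deg b + D.deg b * (D.deg b + D.deg d)) *
    (-1) ^ (D.deg b * (D.deg d + 1)) * (-1) ^ D.deg b * (-1) ^ D.deg c * D.θ c * D.θ d) *
    D.θ_mul_self b

theorem leg2_transp_contr_leg1 (A B : I → I → R) (a b c d : I) :
    (D.leg2 (D.transp B) * D.contr R * leg1 A) (a, c) (b, d) =
      ((-1 : 𝕜) ^ (D.deg a * (D.deg c + D.deg a) + D.deg d + D.deg c * (D.deg a + 1) +
        D.deg a + D.deg d) * (D.θ c * D.θ d)) • (B a (D.bar c) * A (D.bar d) b) := by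
  rw [leg2_contr_leg1, transp, smul_mul_assoc, smul_smul, D.bar_bar, D.deg_bar, D.θ_bar, D.θ_bar]
  congr 1
  linear_combination ((-1 : 𝕜) ^ (D.deg a * (D.deg c + D.deg a) + D.deg d) *
    (-1) ^ (D.deg c * (D.deg a + 1)) * (-1) ^ D.deg a * (-1) ^ D.deg d * D.θ c * D.θ d) *
    D.θ_mul_self a

variable {D}

/-- Each matrix entry is one component relation up to a global sign, which depends only on the
sixteen parity patterns. -/
theorem RTT.rmat_leg1_leg2 {s t : 𝕜} {A B : I → I → R} (h : D.RTT s t A B) :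
    D.rmat R s t * (leg1 A * D.leg2 B) = D.leg2 B * leg1 A * D.rmat R s t := by
  ext ⟨a, c⟩ ⟨b, d⟩
  simp only [rmat, sub_mul, mul_sub, smul_mul_assoc, mul_smul_comm, one_mul, mul_one,
    Matrix.sub_apply, Matrix.smul_apply, perm_mul, mul_perm, leg1_mul_leg2, leg2_mul_leg1]
  have := h a b c d
  rcases D.deg_cases a with ha | ha <;> rcases D.deg_cases b with hb | hb <;>
  rcases D.deg_cases c with hc | hc <;> rcases D.deg_cases d with hd | hd <;>
  simp only [ha, hb, hc, hd] at this ⊢ <;> norm_num at this ⊢ <;>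
  first
  | linear_combination (norm := module) this
  | linear_combination (norm := module) (-1 : 𝕜) • this

/-- Transposing in the first factor turns the permutation into `contr`. The sign of s changes
because the transposed series is taken at -u. -/
theorem RTT.transp_leg1_leg2 {s t : 𝕜} {A B : I → I → R} (h : D.RTT (-s) t A B) :
    leg1 (D.transp A) * D.qmat R s t * D.leg2 B = D.leg2 B * D.qmat R s t * leg1 (D.transp A) := by
  ext ⟨a, c⟩ ⟨b, d⟩
  simp only [qmat, add_mul, mul_add, smul_mul_assoc, mul_smul_comm, mul_one,
    Matrix.add_apply, Matrix.smul_apply, leg1_mul_leg2, leg2_mul_leg1, leg1_transp_contr_leg2,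
    leg2_contr_leg1_transp, transp]
  have := h (D.bar b) (D.bar a) c d
  simp only [D.deg_bar] at this
  rcases D.deg_cases a with ha | ha <;> rcases D.deg_cases b with hb | hb <;>
  rcases D.deg_cases c with hc | hc <;> rcases D.deg_cases d with hd | hd <;>
  simp only [ha, hb, hc, hd] at this ⊢ <;> norm_num at this ⊢ <;>
  first
  | linear_combination (norm := module) (D.θ a * D.θ b) • this
  | linear_combination (norm := module) (-(D.θ a * D.θ b)) • this

theorem RTT.leg1_leg2_transp {s t : 𝕜} {A B : I → I → R} (h : D.RTT (-t) s B A) :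
    leg1 A * D.qmat R s t * D.leg2 (D.transp B) = D.leg2 (D.transp B) * D.qmat R s t * leg1 A := by
  ext ⟨a, c⟩ ⟨b, d⟩
  simp only [qmat, add_mul, mul_add, smul_mul_assoc, mul_smul_comm, mul_one,
    Matrix.add_apply, Matrix.smul_apply, leg1_mul_leg2, leg2_mul_leg1, leg1_contr_leg2_transp,
    leg2_transp_contr_leg1, transp]
  have := h (D.bar d) (D.bar c) a b
  simp only [D.deg_bar] at this
  rcases D.deg_cases a with ha | ha <;> rcases D.deg_cases b with hb | hb <;>
  rcases D.deg_cases c with hc | hc <;> rcases D.deg_cases d with hd | hd <;>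
  simp only [ha, hb, hc, hd] at this ⊢ <;> norm_num at this ⊢ <;>
  first
  | linear_combination (norm := module) (D.θ c * D.θ d) • this
  | linear_combination (norm := module) (-(D.θ c * D.θ d)) • this

theorem RTT.rmat_transp {s t : 𝕜} {A B : I → I → R} (h : D.RTT (-t) (-s) B A) :
    D.rmat R s t * (leg1 (D.transp A) * D.leg2 (D.transp B)) =
      D.leg2 (D.transp B) * leg1 (D.transp A) * D.rmat R s t := by
  ext ⟨a, c⟩ ⟨b, d⟩
  simp only [rmat, sub_mul, mul_sub, smul_mul_assoc, mul_smul_comm, one_mul, mul_one,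
    Matrix.sub_apply, Matrix.smul_apply, perm_mul, mul_perm, leg1_mul_leg2, leg2_mul_leg1, transp]
  have := h (D.bar d) (D.bar c) (D.bar b) (D.bar a)
  simp only [D.deg_bar] at this
  rcases D.deg_cases a with ha | ha <;> rcases D.deg_cases b with hb | hb <;>
  rcases D.deg_cases c with hc | hc <;> rcases D.deg_cases d with hd | hd <;>
  simp only [ha, hb, hc, hd] at this ⊢ <;> norm_num at this ⊢ <;>
  first
  | linear_combination (norm := module) (D.θ a * D.θ b * D.θ c * D.θ d) • this
  | linear_combination (norm := module) (-(D.θ a * D.θ b * D.θ c * D.θ d)) • this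

variable (D)

/-- The product of two families of elements, as matrices. -/
def famMul (A B : I → I → R) (a b : I) : R := ∑ c, A a c * B c b

theorem leg1_famMul (A B : I → I → R) : leg1 (famMul A B) = leg1 A * leg1 B := by
  ext ⟨a, c⟩ ⟨b, d⟩
  by_cases h : c = d <;>
  simp [leg1, famMul, Matrix.mul_apply, Fintype.sum_prod_type, ite_mul, h]

theorem leg2_famMul (A B : I → I → R) : D.leg2 (famMul A B) = D.leg2 A * D.leg2 B := by
  ext ⟨a, c⟩ ⟨b, d⟩
  by_cases h : a = b
  · subst h
    simp only [leg2, famMul, Matrix.mul_apply, Fintype.sum_prod_type, ite_mul, Matrix.of_apply,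
      zero_mul, mul_ite, mul_zero, if_true, Finset.smul_sum]
    simp only [Finset.sum_ite_irrel, Finset.sum_const_zero, Finset.sum_ite_eq',
      Finset.mem_univ, if_true, smul_mul_smul_comm, ← pow_add]
    refine Finset.sum_congr rfl fun e _ => ?_
    congr 1
    rw [show D.deg a * (D.deg c + D.deg e) + D.deg a * (D.deg e + D.deg d) =
      D.deg a * (D.deg c + D.deg d) + 2 * (D.deg a * D.deg e) by ring, pow_add, pow_mul]
    simp
  · simp [leg2, Matrix.mul_apply, Fintype.sum_prod_type, ite_mul, h]

/-- The reflection equation in matrix form. -/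
theorem reflection_matrix {s t : 𝕜} {A B A' B' : I → I → R} (h₁ : D.RTT s t A B)
    (h₂ : D.RTT (-s) t A' B) (h₃ : D.RTT (-t) s B' A) (h₄ : D.RTT (-t) (-s) B' A') :
    D.rmat R s t * (leg1 (famMul A (D.transp A')) * D.qmat R s t *
      D.leg2 (famMul B (D.transp B'))) =
    D.leg2 (famMul B (D.transp B')) * D.qmat R s t * leg1 (famMul A (D.transp A')) *
      D.rmat R s t := by
  have e₁ := h₁.rmat_leg1_leg2
  have e₂ := h₂.transp_leg1_leg2
  have e₃ := h₃.leg1_leg2_transp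
  have e₄ := h₄.rmat_transp
  have e₅ := D.rmat_mul_qmat (R := R) s t
  rw [leg1_famMul, leg2_famMul]
  generalize leg1 A = a at *
  generalize leg1 (D.transp A') = a' at *
  generalize D.leg2 B = b at *
  generalize D.leg2 (D.transp B') = b' at *
  generalize D.rmat R s t = r at *
  generalize D.qmat R s t = q at *
  -- The factors are interchanged pairwise: a' with b across q, a with b across r, r with q, a' with
  -- b' across r, and a with b' across q.
  calc r * (a * a' * q * (b * b')) = r * a * (a' * q * b) * b' := by simp only [mul_assoc]
    _ = r * (a * b) * q * a' * b' := by rw [e₂]; simp only [mul_assoc]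
    _ = b * a * (r * q) * a' * b' := by rw [e₁]; simp only [mul_assoc]
    _ = b * a * q * (r * (a' * b')) := by rw [e₅]; simp only [mul_assoc]
    _ = b * (a * q * b') * a' * r := by rw [e₄]; simp only [mul_assoc]
    _ = b * b' * q * (a * a') * r := by rw [e₃]; simp only [mul_assoc]

/-- The reflection equation in components. -/
theorem reflection {s t : 𝕜} {A B : I → I → R}
    (h : D.rmat R s t * (leg1 A * D.qmat R s t * D.leg2 B) =
      D.leg2 B * D.qmat R s t * leg1 A * D.rmat R s t) (a b c d : I) :
    ((t - s) * (s + t)) • (((-1 : 𝕜) ^ (D.deg b * (D.deg c + D.deg d))) • (A a b * B c d) -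
        ((-1 : 𝕜) ^ (D.deg a * (D.deg c + D.deg d))) • (B c d * A a b)) =
      (s * t * (s + t)) •
        (((-1 : 𝕜) ^ (D.deg a * D.deg c + D.deg b * (D.deg a + D.deg d))) • (A c b * B a d) -
        ((-1 : 𝕜) ^ (D.deg b * D.deg d + D.deg a * (D.deg c + D.deg b))) • (B c b * A a d)) -
      (s * t * (t - s)) •
        (((-1 : 𝕜) ^ (D.deg b + D.deg b * (D.deg b + D.deg d)) * D.θ (D.bar c) * D.θ b) •
          (A a (D.bar c) * B (D.bar b) d) -
        ((-1 : 𝕜) ^ (D.deg a * (D.deg c + D.deg a) + D.deg d) * D.θ a * D.θ (D.bar d)) •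
          (B c (D.bar a) * A (D.bar d) b)) +
      (s * t * (s * t)) •
        (((-1 : 𝕜) ^ (D.deg a * D.deg c + (D.deg b + D.deg b * (D.deg b + D.deg d))) *
            D.θ (D.bar a) * D.θ b) • (A c (D.bar a) * B (D.bar b) d) -
        ((-1 : 𝕜) ^ (D.deg b * D.deg d + (D.deg a * (D.deg c + D.deg a) + D.deg b)) *
            D.θ a * D.θ (D.bar b)) • (B c (D.bar a) * A (D.bar b) d)) := by
  have := congrFun (congrFun h (a, c)) (b, d)
  simp only [rmat, qmat, sub_mul, mul_sub, add_mul, mul_add, smul_mul_assoc, mul_smul_comm,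
    one_mul, mul_one, Matrix.sub_apply, Matrix.add_apply, Matrix.smul_apply, perm_mul, mul_perm,
    leg1_mul_leg2, leg2_mul_leg1, leg1_contr_leg2, leg2_contr_leg1] at this
  linear_combination (norm := module) this

end Matrices
end OspIndex

/-! ### The reflection equation in coefficients. -/

namespace OspIndex

variable {I : Type*}

/-- The same data over a ring. -/
def cast (D : OspIndex I ℤ) (𝕜 : Type*) [CommRing 𝕜] : OspIndex I 𝕜 where
  deg := D.deg
  bar := D.bar
  θ a := D.θ a
  deg_cases := D.deg_cases
  bar_bar := D.bar_bar
  deg_bar := D.deg_bar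
  θ_mul_self a := by rw [← Int.cast_mul, D.θ_mul_self, Int.cast_one]
  θ_bar a := by rw [D.θ_bar]; push_cast; rfl

section Terms

variable {Z : Type*} [Ring Z] (D : OspIndex I ℤ) (g : ℕ → I → I → Z) (a b c d : I) (p q : ℕ)

/-- The graded commutator in the reflection equation. -/
def reflComm : Z :=
  ((-1 : ℤ) ^ (D.deg b * (D.deg c + D.deg d))) • (g p a b * g q c d) -
    ((-1 : ℤ) ^ (D.deg a * (D.deg c + D.deg d))) • (g q c d * g p a b)

/-- The terms of the reflection equation that come from the permutation. -/
def reflPerm : Z :=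
  ((-1 : ℤ) ^ (D.deg a * D.deg c + D.deg b * (D.deg a + D.deg d))) • (g p c b * g q a d) -
    ((-1 : ℤ) ^ (D.deg b * D.deg d + D.deg a * (D.deg c + D.deg b))) • (g q c b * g p a d)

/-- The terms of the reflection equation that come from the transposed permutation. -/
def reflContr : Z :=
  ((-1 : ℤ) ^ (D.deg b + D.deg b * (D.deg b + D.deg d)) * D.θ (D.bar c) * D.θ b) •
      (g p a (D.bar c) * g q (D.bar b) d) -
    ((-1 : ℤ) ^ (D.deg a * (D.deg c + D.deg a) + D.deg d) * D.θ a * D.θ (D.bar d)) •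
      (g q c (D.bar a) * g p (D.bar d) b)

/-- The terms of the reflection equation that come from the product of the permutation and its
transpose. -/
def reflPermContr : Z :=
  ((-1 : ℤ) ^ (D.deg a * D.deg c + (D.deg b + D.deg b * (D.deg b + D.deg d))) *
      D.θ (D.bar a) * D.θ b) • (g p c (D.bar a) * g q (D.bar b) d) -
    ((-1 : ℤ) ^ (D.deg b * D.deg d + (D.deg a * (D.deg c + D.deg a) + D.deg b)) *
      D.θ a * D.θ (D.bar b)) • (g q c (D.bar a) * g p (D.bar b) d)

end Terms

/-- The coefficients of the reflection equation for `g(u) = ∑ g_p u^{-p}`. -/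
structure SatisfiesReflection {Z : Type*} [Ring Z] (D : OspIndex I ℤ) (g : ℕ → I → I → Z) :
    Prop where
  zero : ∀ a b c d q, D.reflComm g a b c d 0 q = 0
  one : ∀ a b c d q, D.reflComm g a b c d 1 q =
    D.reflPerm g a b c d 0 q - D.reflContr g a b c d 0 q
  add_two : ∀ a b c d p q, D.reflComm g a b c d (p + 2) q - D.reflComm g a b c d p (q + 2) =
    D.reflPerm g a b c d p (q + 1) + D.reflPerm g a b c d (p + 1) q -
      (D.reflContr g a b c d (p + 1) q - D.reflContr g a b c d p (q + 1)) +
      D.reflPermContr g a b c d p q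

section Maps

variable {Z Z' : Type*} [Ring Z] [Ring Z'] (D : OspIndex I ℤ) (g : ℕ → I → I → Z) (φ : Z →+* Z')

theorem map_reflComm (a b c d : I) (p q : ℕ) : φ (D.reflComm g a b c d p q) =
    D.reflComm (fun p a b => φ (g p a b)) a b c d p q := by
  simp only [reflComm, map_sub, map_zsmul, map_mul]

theorem map_reflPerm (a b c d : I) (p q : ℕ) : φ (D.reflPerm g a b c d p q) =
    D.reflPerm (fun p a b => φ (g p a b)) a b c d p q := by
  simp only [reflPerm, map_sub, map_zsmul, map_mul]

theorem map_reflContr (a b c d : I) (p q : ℕ) : φ (D.reflContr g a b c d p q) =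
    D.reflContr (fun p a b => φ (g p a b)) a b c d p q := by
  simp only [reflContr, map_sub, map_zsmul, map_mul]

theorem map_reflPermContr (a b c d : I) (p q : ℕ) : φ (D.reflPermContr g a b c d p q) =
    D.reflPermContr (fun p a b => φ (g p a b)) a b c d p q := by
  simp only [reflPermContr, map_sub, map_zsmul, map_mul]

variable {D g}

theorem SatisfiesReflection.map (h : D.SatisfiesReflection g) :
    D.SatisfiesReflection fun p a b => φ (g p a b) where
  zero a b c d q := by rw [← map_reflComm, h.zero, map_zero]
  one a b c d q := by
    rw [← map_reflComm, ← map_reflPerm, ← map_reflContr, ← map_sub, h.one]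
  add_two a b c d p q := by
    simp only [← map_reflComm, ← map_reflPerm, ← map_reflContr, ← map_reflPermContr, ← map_sub,
      ← map_add, h.add_two]

/-- Relations computed in the super Yangian descend in this way to its subalgebra. -/
theorem SatisfiesReflection.of_injective {φ : Z →+* Z'} (hφ : Function.Injective φ)
    (h : D.SatisfiesReflection fun p a b => φ (g p a b)) : D.SatisfiesReflection g where
  zero a b c d q := hφ (by rw [map_reflComm, h.zero, map_zero])
  one a b c d q := hφ (by rw [map_sub, map_reflComm, map_reflPerm, map_reflContr, h.one])
  add_two a b c d p q := by
    refine hφ ?_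
    simp only [map_sub, map_add, map_reflComm, map_reflPerm, map_reflContr, map_reflPermContr]
    exact h.add_two a b c d p q

end Maps

end OspIndex

/-! ### Power series in two variables -/

noncomputable section

namespace BiSeries

open PowerSeries

variable {Z : Type*} [Ring Z]

/-- The coefficient at `x ^ p * y ^ q`. -/
def cf (p q : ℕ) : Z⟦X⟧⟦X⟧ →+ Z :=
  (coeff (R := Z) q).toAddMonoidHom.comp (coeff (R := Z⟦X⟧) p).toAddMonoidHom

variable (Z) in
/-- The scalars of the ring of power series in two variables. -/
abbrev BiCenter : Type _ := Subring.center Z⟦X⟧⟦X⟧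

variable (Z) in
/-- The first variable. -/
def x : BiCenter Z :=
  ⟨X, Subring.mem_center_iff.2 fun z => (commute_X z).eq⟩

variable (Z) in
/-- The second variable. -/
def y : BiCenter Z :=
  ⟨C X, Subring.mem_center_iff.2 fun z => by
    ext1 p
    rw [coeff_mul_C, coeff_C_mul]
    exact (commute_X _).eq⟩

theorem ext_cf {z w : Z⟦X⟧⟦X⟧} (h : ∀ p q, cf p q z = cf p q w) : z = w := by
  ext p q; exact h p q

@[simp] theorem cf_zero_x (q : ℕ) (z : Z⟦X⟧⟦X⟧) : cf 0 q (x Z • z) = 0 := by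
  change coeff q (coeff 0 (X * z)) = 0
  simp

@[simp] theorem cf_succ_x (p q : ℕ) (z : Z⟦X⟧⟦X⟧) : cf (p + 1) q (x Z • z) = cf p q z := by
  change coeff q (coeff (p + 1) (X * z)) = _
  rw [coeff_succ_X_mul]; rfl

@[simp] theorem cf_zero_y (p : ℕ) (z : Z⟦X⟧⟦X⟧) : cf p 0 (y Z • z) = 0 := by
  change coeff 0 (coeff p (C X * z)) = 0
  simp [coeff_C_mul]

@[simp] theorem cf_succ_y (p q : ℕ) (z : Z⟦X⟧⟦X⟧) : cf p (q + 1) (y Z • z) = cf p q z := by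
  change coeff (q + 1) (coeff p (C X * z)) = _
  rw [coeff_C_mul, coeff_succ_X_mul]; rfl

/-- The series `∑ f_p x ^ p`. -/
def inX (f : ℕ → Z) : Z⟦X⟧⟦X⟧ := PowerSeries.map (C (R := Z)) (PowerSeries.mk f)

/-- The series `∑ f_q y ^ q`. -/
def inY (f : ℕ → Z) : Z⟦X⟧⟦X⟧ := C (PowerSeries.mk f)

@[simp] theorem cf_inX_mul_inY (f g : ℕ → Z) (p q : ℕ) : cf p q (inX f * inY g) = f p * g q := by
  simp [cf, inX, inY, coeff_C_mul, coeff_mul_C]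

@[simp] theorem cf_inY_mul_inX (f g : ℕ → Z) (p q : ℕ) : cf p q (inY g * inX f) = g q * f p := by
  simp [cf, inX, inY, coeff_C_mul, coeff_mul_C]

theorem cast_smul (k : ℤ) (z : Z⟦X⟧⟦X⟧) : ((k : BiCenter Z)) • z = k • z :=
  Int.cast_smul_eq_zsmul _ _ _

variable {I : Type*} (D : OspIndex I ℤ)

/-- The coefficients of the RTT relation. -/
structure CoeffRTT (t : ℕ → I → I → Z) : Prop where
  comm_zero : ∀ a b c d q, t 0 a b * t q c d =
    ((-1 : ℤ) ^ ((D.deg a + D.deg b) * (D.deg c + D.deg d))) • (t q c d * t 0 a b)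
  zero_comm : ∀ a b c d q, t q a b * t 0 c d =
    ((-1 : ℤ) ^ ((D.deg a + D.deg b) * (D.deg c + D.deg d))) • (t 0 c d * t q a b)
  succ : ∀ a b c d p q,
    (t (p + 1) a b * t q c d -
      ((-1 : ℤ) ^ ((D.deg a + D.deg b) * (D.deg c + D.deg d))) • (t q c d * t (p + 1) a b)) -
    (t p a b * t (q + 1) c d -
      ((-1 : ℤ) ^ ((D.deg a + D.deg b) * (D.deg c + D.deg d))) • (t (q + 1) c d * t p a b)) =
    ((-1 : ℤ) ^ (D.deg a * D.deg b + (D.deg a + D.deg b) * D.deg c)) •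
      (t p c b * t q a d - t q c b * t p a d)

/-- The series `∑ e ^ p f_p x ^ p` for a family of sequences. -/
def famX (e : ℤ) (t : ℕ → I → I → Z) (a b : I) : Z⟦X⟧⟦X⟧ := inX fun p => e ^ p • t p a b

/-- The series `∑ e ^ q f_q y ^ q` for a family of sequences. -/
def famY (e : ℤ) (t : ℕ → I → I → Z) (a b : I) : Z⟦X⟧⟦X⟧ := inY fun p => e ^ p • t p a b

variable {D} in
-- Here x and y stand for u⁻¹ and v⁻¹; they serve as scalars by being central, as the coefficients
-- do not commute. Rescaling by e and e' multiplies the coefficient at x^p y^q by e^p e'^q, so the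
-- values ±1 cover T(u) and T(-u) at once.
theorem CoeffRTT.rtt {t : ℕ → I → I → Z} (h : CoeffRTT D t) (e e' : ℤ) :
    (D.cast (BiCenter Z)).RTT ((e : BiCenter Z) * x Z)
      ((e' : BiCenter Z) * y Z) (famX e t) (famY e' t) := by
  intro a b c d
  have h₀ := h.comm_zero a b c d
  have h₁ := h.zero_comm a b c d
  have h₂ := h.succ a b c d
  simp only [OspIndex.cast]
  generalize (D.deg a + D.deg b) * (D.deg c + D.deg d) = k at *
  generalize D.deg a * D.deg b + (D.deg a + D.deg b) * D.deg c = l at *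
  have hk : ((-1 : BiCenter Z)) ^ k = (((-1) ^ k : ℤ) : BiCenter Z) := by
    push_cast; rfl
  have hl : ((-1 : BiCenter Z)) ^ l = (((-1) ^ l : ℤ) : BiCenter Z) := by
    push_cast; rfl
  rw [hk, hl]
  generalize ((-1) ^ k : ℤ) = k at *
  generalize ((-1) ^ l : ℤ) = l at *
  -- The commutator has no terms of degree zero in either variable, so the boundary coefficients of
  -- the equation are trivial.
  have E₀ : ∀ q, cf 0 q (famX e t a b * famY e' t c d -
      (k : BiCenter Z) • (famY e' t c d * famX e t a b)) = 0 := by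
    intro q
    simp only [cast_smul, map_sub, map_zsmul, famX, famY, cf_inX_mul_inY, cf_inY_mul_inX,
      pow_zero, one_smul, mul_smul_comm, smul_mul_assoc, h₀]
    module
  have E₁ : ∀ p, cf p 0 (famX e t a b * famY e' t c d -
      (k : BiCenter Z) • (famY e' t c d * famX e t a b)) = 0 := by
    intro p
    simp only [cast_smul, map_sub, map_zsmul, famX, famY, cf_inX_mul_inY, cf_inY_mul_inX,
      pow_zero, one_smul, mul_smul_comm, smul_mul_assoc, h₁]
    module
  refine ext_cf fun p q => ?_
  rw [show (e : BiCenter Z) * x Z * ((e' : BiCenter Z) * y Z) * (l : BiCenter Z) =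
    ((e * e' * l : ℤ) : BiCenter Z) * (x Z * y Z) by push_cast; ring]
  simp only [sub_smul, mul_smul (_ : BiCenter Z), map_sub, cast_smul, map_zsmul]
    at E₀ E₁ ⊢
  rcases p with _ | p <;> rcases q with _ | q
  · simp
  · simp only [cf_succ_y, cf_zero_x, smul_zero, sub_zero, map_zsmul, map_sub, E₀]
  · simp only [cf_zero_y, cf_succ_x, smul_zero, sub_zero, map_zsmul, map_sub, E₁]
  · simp only [cf_succ_y, cf_succ_x, map_zsmul, map_sub, famX, famY, cf_inX_mul_inY,
      cf_inY_mul_inX, mul_smul_comm, smul_mul_assoc]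
    linear_combination (norm := module) (e ^ (p + 1) * e' ^ (q + 1)) • h₂ p q

variable {D} in
theorem CoeffRTT.rtt_symm {t : ℕ → I → I → Z} (h : CoeffRTT D t) (e e' : ℤ) :
    (D.cast (BiCenter Z)).RTT ((e' : BiCenter Z) * y Z)
      ((e : BiCenter Z) * x Z) (famY e' t) (famX e t) := by
  intro a b c d
  have h₀ := h.comm_zero a b c d
  have h₁ := h.zero_comm a b c d
  have h₂ := h.succ a b c d
  simp only [OspIndex.cast]
  generalize (D.deg a + D.deg b) * (D.deg c + D.deg d) = k at *
  generalize D.deg a * D.deg b + (D.deg a + D.deg b) * D.deg c = l at *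
  have hk : ((-1 : BiCenter Z)) ^ k = (((-1) ^ k : ℤ) : BiCenter Z) := by
    push_cast; rfl
  have hl : ((-1 : BiCenter Z)) ^ l = (((-1) ^ l : ℤ) : BiCenter Z) := by
    push_cast; rfl
  rw [hk, hl]
  generalize ((-1) ^ k : ℤ) = k at *
  generalize ((-1) ^ l : ℤ) = l at *
  have E₀ : ∀ q, cf 0 q (famY e' t a b * famX e t c d -
      (k : BiCenter Z) • (famX e t c d * famY e' t a b)) = 0 := by
    intro q
    simp only [cast_smul, map_sub, map_zsmul, famX, famY, cf_inX_mul_inY, cf_inY_mul_inX,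
      pow_zero, one_smul, mul_smul_comm, smul_mul_assoc, h₁]
    module
  have E₁ : ∀ p, cf p 0 (famY e' t a b * famX e t c d -
      (k : BiCenter Z) • (famX e t c d * famY e' t a b)) = 0 := by
    intro p
    simp only [cast_smul, map_sub, map_zsmul, famX, famY, cf_inX_mul_inY, cf_inY_mul_inX,
      pow_zero, one_smul, mul_smul_comm, smul_mul_assoc, h₀]
    module
  refine ext_cf fun p q => ?_
  rw [show (e' : BiCenter Z) * y Z * ((e : BiCenter Z) * x Z) * (l : BiCenter Z) =
    ((e * e' * l : ℤ) : BiCenter Z) * (x Z * y Z) by push_cast; ring]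
  simp only [sub_smul, mul_smul (_ : BiCenter Z), map_sub, cast_smul, map_zsmul]
    at E₀ E₁ ⊢
  rcases p with _ | p <;> rcases q with _ | q
  · simp
  · simp only [cf_succ_y, cf_zero_x, smul_zero, sub_zero, map_zsmul, map_sub, E₀]
  · simp only [cf_zero_y, cf_succ_x, smul_zero, sub_zero, map_zsmul, map_sub, E₁]
  · simp only [cf_succ_y, cf_succ_x, map_zsmul, map_sub, famX, famY, cf_inX_mul_inY,
      cf_inY_mul_inX, mul_smul_comm, smul_mul_assoc]
    linear_combination (norm := module) (e ^ (p + 1) * e' ^ (q + 1)) • h₂ q p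

theorem _root_.OspIndex.transp_cast_smul (A : I → I → Z⟦X⟧⟦X⟧) (a b : I) :
    (D.cast (BiCenter Z)).transp A a b =
      ((-1 : ℤ) ^ (D.deg a * (D.deg b + 1)) * D.θ a * D.θ b) • A (D.bar b) (D.bar a) := by
  rw [OspIndex.transp, ← cast_smul]
  push_cast
  rfl

end BiSeries

end

/-! ### The series S(u): reflection equation and symmetry relation. -/

noncomputable section

namespace BiSeries

open PowerSeries

variable {Z I : Type*} [Ring Z] [Fintype I] (D : OspIndex I ℤ)

/-- The coefficients of the product of `t(u)` and of the transpose of `t(-u)`. -/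
def twist (t : ℕ → I → I → Z) (p : ℕ) (a b : I) : Z :=
  ∑ ij ∈ Finset.HasAntidiagonal.antidiagonal p, ∑ c,
    ((-1 : ℤ) ^ (D.deg c * (D.deg b + 1)) * D.θ c * D.θ b * (-1) ^ ij.2) •
      (t ij.1 a c * t ij.2 (D.bar b) (D.bar c))

theorem sum_mk_mul (t : ℕ → I → I → Z) (a b : I) :
    ∑ c, PowerSeries.mk (fun p => (1 : ℤ) ^ p • t p a c) *
      (((-1 : ℤ) ^ (D.deg c * (D.deg b + 1)) * D.θ c * D.θ b) •
        PowerSeries.mk fun p => (-1 : ℤ) ^ p • t p (D.bar b) (D.bar c)) =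
      PowerSeries.mk fun p => (1 : ℤ) ^ p • twist D t p a b := by
  ext p
  simp only [map_sum, coeff_mul, coeff_mk, map_zsmul, one_pow, one_smul, twist]
  rw [Finset.sum_comm]
  refine Finset.sum_congr rfl fun ij _ => Finset.sum_congr rfl fun c _ => ?_
  rw [smul_smul, mul_smul_comm]

theorem famMul_famX (t : ℕ → I → I → Z) :
    OspIndex.famMul (famX 1 t) ((D.cast (BiCenter Z)).transp (famX (-1) t)) =
      famX 1 (twist D t) := by
  funext a b
  rw [OspIndex.famMul, famX, inX, ← sum_mk_mul, map_sum]
  refine Finset.sum_congr rfl fun c _ => ?_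
  rw [D.transp_cast_smul, map_mul, map_zsmul]
  rfl

theorem famMul_famY (t : ℕ → I → I → Z) :
    OspIndex.famMul (famY 1 t) ((D.cast (BiCenter Z)).transp (famY (-1) t)) =
      famY 1 (twist D t) := by
  funext a b
  rw [OspIndex.famMul, famY, inY, ← sum_mk_mul, map_sum]
  refine Finset.sum_congr rfl fun c _ => ?_
  rw [D.transp_cast_smul, map_mul, map_zsmul]
  rfl

variable {D} in
/-- The reflection equation for the coefficients. -/
theorem CoeffRTT.satisfiesReflection [DecidableEq I] {t : ℕ → I → I → Z} (h : CoeffRTT D t) :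
    D.SatisfiesReflection (twist D t) := by
  -- The four relations pair T(±u) with T(±v), as `reflection_matrix` requires.
  have h₁ := h.rtt 1 1
  have h₂ := h.rtt (-1) 1
  have h₃ := h.rtt_symm 1 (-1)
  have h₄ := h.rtt_symm (-1) (-1)
  simp only [Int.cast_one, one_mul, Int.cast_neg, neg_mul] at h₁ h₂ h₃ h₄
  have H := (D.cast (BiCenter Z)).reflection_matrix h₁ h₂ h₃ h₄
  rw [famMul_famX, famMul_famY] at H
  have H := (D.cast (BiCenter Z)).reflection H
  have key : ∀ a b c d, ∃ F G K L : Z⟦X⟧⟦X⟧,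
      (∀ p q, cf p q F = D.reflComm (twist D t) a b c d p q) ∧
      (∀ p q, cf p q G = D.reflPerm (twist D t) a b c d p q) ∧
      (∀ p q, cf p q K = D.reflContr (twist D t) a b c d p q) ∧
      (∀ p q, cf p q L = D.reflPermContr (twist D t) a b c d p q) ∧
      ((y Z - x Z) * (x Z + y Z)) • F = (x Z * y Z * (x Z + y Z)) • G -
        (x Z * y Z * (y Z - x Z)) • K + (x Z * y Z * (x Z * y Z)) • L := by
    intro a b c d
    have := H a b c d
    refine ⟨_, _, _, _, fun p q => ?_, fun p q => ?_, fun p q => ?_, fun p q => ?_, this⟩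
    all_goals
      have e : ((-1 : BiCenter Z)) = ((-1 : ℤ) : BiCenter Z) := by push_cast; rfl
      simp only [OspIndex.cast, e, ← Int.cast_pow, ← Int.cast_mul, cast_smul, map_sub, map_zsmul,
        famX, famY, cf_inX_mul_inY, cf_inY_mul_inX, one_pow, one_smul]
      rfl
  replace key : ∀ a b c d, ∃ F G K L : Z⟦X⟧⟦X⟧,
      (∀ p q, cf p q F = D.reflComm (twist D t) a b c d p q) ∧
      (∀ p q, cf p q G = D.reflPerm (twist D t) a b c d p q) ∧
      (∀ p q, cf p q K = D.reflContr (twist D t) a b c d p q) ∧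
      (∀ p q, cf p q L = D.reflPermContr (twist D t) a b c d p q) ∧
      y Z • y Z • F - x Z • x Z • F = x Z • x Z • y Z • G + x Z • y Z • y Z • G -
        (x Z • y Z • y Z • K - x Z • x Z • y Z • K) + x Z • x Z • y Z • y Z • L := by
    intro a b c d
    obtain ⟨F, G, K, L, hF, hG, hK, hL, h⟩ := key a b c d
    exact ⟨F, G, K, L, hF, hG, hK, hL, by linear_combination (norm := module) h⟩
  -- The three families are the coefficients at x^0 y^{q+2}, x^1 y^{q+2} and x^{p+2} y^{q+2}.
  constructor
  · intro a b c d q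
    obtain ⟨F, G, K, L, hF, hG, hK, hL, h⟩ := key a b c d
    have := congrArg (cf 0 (q + 2)) h
    simp only [map_sub, map_add, cf_succ_y, cf_zero_x, hF] at this
    simpa using this
  · intro a b c d q
    obtain ⟨F, G, K, L, hF, hG, hK, hL, h⟩ := key a b c d
    have := congrArg (cf 1 (q + 2)) h
    rw [show 1 = 0 + 1 from rfl] at this
    simp only [map_sub, map_add, cf_succ_y, cf_succ_x, cf_zero_x, hF, hG, hK] at this
    simpa using this
  · intro a b c d p q
    obtain ⟨F, G, K, L, hF, hG, hK, hL, h⟩ := key a b c d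
    have := congrArg (cf (p + 2) (q + 2)) h
    simp only [map_sub, map_add, cf_succ_y, cf_succ_x, hF, hG, hK, hL] at this
    exact this

/-- Dropping the vanishing term at one end or at the other writes the same alternating sum in two
ways, with opposite signs; add them. This is the factor u - v becoming 2u at v = -u. -/
theorem two_nsmul_sum_antidiagonal (f : ℕ → ℕ → Z) (h₀ : ∀ j, f 0 j = 0) (h₁ : ∀ i, f i 0 = 0)
    (p : ℕ) : (2 : ℤ) • ∑ ij ∈ Finset.HasAntidiagonal.antidiagonal (p + 1), ((-1 : ℤ) ^ ij.2) • f ij.1 ij.2 =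
      ∑ ij ∈ Finset.HasAntidiagonal.antidiagonal p, ((-1 : ℤ) ^ ij.2) • (f (ij.1 + 1) ij.2 - f ij.1 (ij.2 + 1)) := by
  have e₁ := Finset.Nat.sum_antidiagonal_succ (n := p)
    (f := fun ij : ℕ × ℕ => ((-1 : ℤ) ^ ij.2) • f ij.1 ij.2)
  have e₂ := Finset.Nat.sum_antidiagonal_succ' (n := p)
    (f := fun ij : ℕ × ℕ => ((-1 : ℤ) ^ ij.2) • f ij.1 ij.2)
  simp only [h₀, h₁, smul_zero, zero_add, pow_succ, mul_neg, mul_one, neg_smul,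
    Finset.sum_neg_distrib] at e₁ e₂
  rw [two_smul]
  simp only [smul_sub, Finset.sum_sub_distrib]
  nth_rewrite 1 [e₁]
  rw [e₂, sub_eq_add_neg]

variable {D} in
/-- The symmetry relation for the diagonal coefficients. -/
theorem CoeffRTT.twist_symm {t : ℕ → I → I → Z} (h : CoeffRTT D t) (p : ℕ) (a : I) :
    (2 : ℤ) • (twist D t (p + 1) a a -
      ((-1 : ℤ) ^ (p + 1)) • twist D t (p + 1) (D.bar a) (D.bar a)) =
      twist D t p (D.bar a) (D.bar a) - ((-1 : ℤ) ^ p) • twist D t p (D.bar a) (D.bar a) := by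
  let σ : I → ℤ := fun c => (-1) ^ (D.deg c * (D.deg a + 1)) * D.θ c * D.θ a
  let σ' : I → ℤ := fun c => (-1) ^ (D.deg c * (D.deg a + 1)) * D.θ c * ((-1) ^ D.deg a * D.θ a)
  have E₁ : ∀ p, twist D t p a a = ∑ c, σ c • ∑ ij ∈ Finset.HasAntidiagonal.antidiagonal p,
      ((-1 : ℤ) ^ ij.2) • (t ij.1 a c * t ij.2 (D.bar a) (D.bar c)) := fun p => by
    rw [twist, Finset.sum_comm]
    refine Finset.sum_congr rfl fun c _ => ?_
    rw [Finset.smul_sum]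
    exact Finset.sum_congr rfl fun ij _ => by rw [smul_smul]
  have E₂ : ∀ p, twist D t p (D.bar a) (D.bar a) = ∑ c, σ' c • ∑ ij ∈ Finset.HasAntidiagonal.antidiagonal p,
      ((-1 : ℤ) ^ ij.2) • (t ij.1 (D.bar a) c * t ij.2 a (D.bar c)) := fun p => by
    rw [twist, Finset.sum_comm]
    refine Finset.sum_congr rfl fun c _ => ?_
    rw [Finset.smul_sum]
    exact Finset.sum_congr rfl fun ij _ => by
      rw [smul_smul, D.bar_bar, D.θ_bar, D.deg_bar]
  have E₃ : ∀ p, ((-1 : ℤ) ^ p) • twist D t p (D.bar a) (D.bar a) =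
      ∑ c, σ' c • ∑ ij ∈ Finset.HasAntidiagonal.antidiagonal p,
        ((-1 : ℤ) ^ ij.2) • (t ij.2 (D.bar a) c * t ij.1 a (D.bar c)) := fun p => by
    rw [E₂, Finset.smul_sum]
    refine Finset.sum_congr rfl fun c _ => ?_
    rw [smul_comm]
    congr 1
    rw [← Finset.Nat.sum_antidiagonal_swap, Finset.smul_sum]
    refine Finset.sum_congr rfl fun ij hij => ?_
    rw [smul_smul, ← Finset.HasAntidiagonal.mem_antidiagonal.1 hij, pow_add, mul_right_comm, ← pow_add,
      Prod.snd_swap, Prod.fst_swap, ← two_mul, pow_mul, neg_one_sq, one_pow, one_mul]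
  -- After c ↦ bar c the terms are those of `E₁` with reversed factors and the graded sign, so the
  -- difference from `E₁` is a sum of graded commutators.
  have E₄ : ∀ p, ((-1 : ℤ) ^ p) • twist D t p (D.bar a) (D.bar a) =
      ∑ c, σ c • ∑ ij ∈ Finset.HasAntidiagonal.antidiagonal p,
        ((-1 : ℤ) ^ ij.2) • (((-1 : ℤ) ^ ((D.deg a + D.deg c) *
          (D.deg (D.bar a) + D.deg (D.bar c)))) •
            (t ij.2 (D.bar a) (D.bar c) * t ij.1 a c)) := fun p => by
    rw [E₃, ← (Function.Involutive.bijective (f := D.bar) D.bar_bar).sum_comp]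
    refine Finset.sum_congr rfl fun c _ => ?_
    simp only [D.bar_bar, D.deg_bar,
      smul_comm _ ((-1 : ℤ) ^ ((D.deg a + D.deg c) * (D.deg a + D.deg c))), ← Finset.smul_sum]
    rw [smul_smul]
    congr 1
    simp only [σ, σ', D.deg_bar, D.θ_bar]
    rcases D.deg_cases a with ha | ha <;> rcases D.deg_cases c with hc | hc <;> simp [ha, hc]
  rw [E₁, E₄, E₂, ← E₂, E₃, E₂, ← Finset.sum_sub_distrib, ← Finset.sum_sub_distrib,
    Finset.smul_sum]
  refine Finset.sum_congr rfl fun c _ => ?_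
  rw [← smul_sub, ← smul_sub, ← Finset.sum_sub_distrib, ← Finset.sum_sub_distrib, smul_comm]
  simp only [← smul_sub]
  rw [two_nsmul_sum_antidiagonal (fun i j => t i a c * t j (D.bar a) (D.bar c) -
    ((-1 : ℤ) ^ ((D.deg a + D.deg c) * (D.deg (D.bar a) + D.deg (D.bar c)))) •
      (t j (D.bar a) (D.bar c) * t i a c))
    (fun j => sub_eq_zero.2 (h.comm_zero _ _ _ _ _)) (fun i => sub_eq_zero.2 (h.zero_comm _ _ _ _ _))]
  -- The RTT relation turns the differences of commutators into exactly the products in `E₂` and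
  -- `E₃`.
  simp only [h.succ, Finset.smul_sum, smul_smul]
  refine Finset.sum_congr rfl fun ij _ => ?_
  congr 1
  simp only [σ, σ', D.deg_bar]
  rcases D.deg_cases a with ha | ha <;> rcases D.deg_cases c with hc | hc <;> simp [ha, hc]

end BiSeries

end

/-! ### The Cartan grading element. -/

noncomputable section

namespace BiSeries

variable {Z I : Type*} [Ring Z] [Fintype I] [DecidableEq I] {D : OspIndex I ℤ}
  {t : ℕ → I → I → Z}

theorem twist_zero (h₀ : ∀ a b, t 0 a b = if a = b then 1 else 0) (a b : I) :
    twist D t 0 a b = if a = b then 1 else 0 := by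
  have hb : ∀ c, D.bar b = D.bar c ↔ b = c := fun c =>
    ⟨fun h => by rw [← D.bar_bar b, h, D.bar_bar], fun h => by rw [h]⟩
  have h : Finset.HasAntidiagonal.antidiagonal 0 = {(0, 0)} := rfl
  simp only [twist, h, Finset.sum_singleton, h₀, hb]
  by_cases hab : a = b
  · subst hab
    rw [Finset.sum_eq_single a]
    · have : (-1 : ℤ) ^ (D.deg a * (D.deg a + 1)) = 1 := (Nat.even_mul_succ_self _).neg_one_pow
      simp [this, D.θ_mul_self, -zsmul_eq_mul]
    · intro c _ hc
      simp [Ne.symm hc]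
    · simp
  · rw [if_neg hab]
    refine Finset.sum_eq_zero fun c _ => ?_
    by_cases hc : a = c
    · simp [← hc, Ne.symm hab]
    · simp [hc]

theorem twist_one_diag (h₀ : ∀ a b, t 0 a b = if a = b then 1 else 0) (a : I) :
    twist D t 1 a a = t 1 a a - t 1 (D.bar a) (D.bar a) := by
  have hb : ∀ b c, D.bar b = D.bar c ↔ b = c := fun b c =>
    ⟨fun h => by rw [← D.bar_bar b, h, D.bar_bar], fun h => by rw [h]⟩
  have e : (-1 : ℤ) ^ (D.deg a * (D.deg a + 1)) = 1 := (Nat.even_mul_succ_self _).neg_one_pow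
  have : Finset.HasAntidiagonal.antidiagonal 1 = {(0, 1), (1, 0)} := rfl
  simp [twist, this, h₀, hb, e, D.θ_mul_self, mul_assoc, -zsmul_eq_mul]
  abel

/-- The element of the Cartan subalgebra with the given weights. -/
def cartan (D : OspIndex I ℤ) (t : ℕ → I → I → Z) (ht : I → ℤ) : Z :=
  ∑ e, (ht e * (-1) ^ D.deg e) • t 1 e e

/-- The degree-one diagonal coefficient is t^{aa} - t^{bar a, bar a}. As ht is odd under bar, the
reflected terms add up to a second copy. -/
theorem cartan_twist (h₀ : ∀ a b, t 0 a b = if a = b then 1 else 0) {ht : I → ℤ}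
    (hht : ∀ a, ht (D.bar a) = - ht a) :
    cartan D (twist D t) ht = (2 : ℤ) • cartan D t ht := by
  have : ∑ e, (ht e * (-1) ^ D.deg e) • t 1 (D.bar e) (D.bar e) = - cartan D t ht := by
    rw [← (Function.Involutive.bijective (f := D.bar) D.bar_bar).sum_comp, cartan,
      ← Finset.sum_neg_distrib]
    refine Finset.sum_congr rfl fun e _ => ?_
    rw [D.bar_bar, D.deg_bar, hht]
    module
  simp only [cartan, twist_one_diag h₀, smul_sub, Finset.sum_sub_distrib] at this ⊢
  rw [this]
  module

/-- The RTT relation gives [t₁^{ee}, -] a sign (-1)^{deg e}, cancelled by the one built into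
`cartan`. -/
theorem CoeffRTT.cartan_comm (h : CoeffRTT D t) (h₀ : ∀ a b, t 0 a b = if a = b then 1 else 0)
    (ht : I → ℤ) (p : ℕ) (a b : I) :
    cartan D t ht * t p a b - t p a b * cartan D t ht = (ht a - ht b) • t p a b := by
  have key : ∀ e, t 1 e e * t p a b - t p a b * t 1 e e =
      ((-1 : ℤ) ^ D.deg e) • ((if a = e then t p e b else 0) - if e = b then t p a e else 0) := by
    intro e
    have e₁ : (-1 : ℤ) ^ ((D.deg e + D.deg e) * (D.deg a + D.deg b)) = 1 :=
      ((Even.add_self _).mul_right _).neg_one_pow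
    have e₂ : (-1 : ℤ) ^ (D.deg e * D.deg e + (D.deg e + D.deg e) * D.deg a) =
        (-1) ^ D.deg e := by
      rw [pow_add, ((Even.add_self (D.deg e)).mul_right _).neg_one_pow, mul_one]
      rcases D.deg_cases e with he | he <;> simp [he]
    have h₁ := h.succ e e a b 0 p
    rw [h.comm_zero e e a b, sub_self, sub_zero, e₁, e₂, one_smul, h₀, h₀] at h₁
    rw [h₁]
    simp
  simp only [cartan, Finset.sum_mul, Finset.mul_sum, smul_mul_assoc, mul_smul_comm,
    ← Finset.sum_sub_distrib, ← smul_sub, key, smul_smul]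
  simp only [smul_sub, Finset.sum_sub_distrib, smul_ite, smul_zero, Finset.sum_ite_eq,
    Finset.sum_ite_eq', Finset.mem_univ, if_true, mul_assoc, ← pow_add,
    (Even.add_self _).neg_one_pow, mul_one, sub_smul]

/-- In t^{ac} t^{bar b, bar c} the contributions of the summation index c cancel because ht is odd,
so all summands have the same weight. -/
theorem CoeffRTT.cartan_comm_twist (h : CoeffRTT D t)
    (h₀ : ∀ a b, t 0 a b = if a = b then 1 else 0) {ht : I → ℤ}
    (hht : ∀ a, ht (D.bar a) = - ht a) (p : ℕ) (a b : I) :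
    cartan D (twist D t) ht * twist D t p a b - twist D t p a b * cartan D (twist D t) ht =
      (2 * (ht a - ht b)) • twist D t p a b := by
  have key : ∀ i j c, cartan D t ht * (t i a c * t j (D.bar b) (D.bar c)) -
      t i a c * t j (D.bar b) (D.bar c) * cartan D t ht =
        (ht a - ht b) • (t i a c * t j (D.bar b) (D.bar c)) := by
    intro i j c
    calc _ = (cartan D t ht * t i a c - t i a c * cartan D t ht) * t j (D.bar b) (D.bar c) +
        t i a c * (cartan D t ht * t j (D.bar b) (D.bar c) -
          t j (D.bar b) (D.bar c) * cartan D t ht) := by noncomm_ring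
      _ = _ := by
        rw [h.cartan_comm h₀, h.cartan_comm h₀, hht, hht, smul_mul_assoc, mul_smul_comm]
        module
  rw [cartan_twist h₀ hht, smul_mul_assoc, mul_smul_comm, ← smul_sub, mul_smul]
  congr 1
  simp only [twist, Finset.mul_sum, Finset.sum_mul, ← Finset.sum_sub_distrib, Finset.smul_sum,
    smul_mul_assoc, mul_smul_comm, ← smul_sub, key]
  refine Finset.sum_congr rfl fun ij _ => Finset.sum_congr rfl fun c _ => ?_
  rw [smul_comm]

end BiSeries

/-! ### The relations in the twisted super Yangian. -/

namespace TwistedSuperYangian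

open BiSeries

/-- The index data of `Y(M|2n)^+`. -/
def index (M n : ℕ) : OspIndex (Fin (M + 2 * n)) ℤ where
  deg := deg M
  bar := bar
  θ a := if (a : ℕ) < M + n then 1 else -1
  deg_cases a := by unfold deg; split_ifs <;> simp
  bar_bar a := by
    have := a.isLt
    ext
    by_cases h : (a : ℕ) < M
    · have : M - 1 - (a : ℕ) < M := by omega
      simp [bar, h, this]; omega
    · have : ¬ 2 * M + 2 * n - 1 - (a : ℕ) < M := by omega
      simp [bar, h, this]; omega
  deg_bar a := by
    have := a.isLt
    by_cases h : (a : ℕ) < M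
    · have : M - 1 - (a : ℕ) < M := by omega
      simp [deg, bar, h, this]
    · have : ¬ 2 * M + 2 * n - 1 - (a : ℕ) < M := by omega
      simp [deg, bar, h, this]
  θ_mul_self a := by split_ifs <;> norm_num
  θ_bar a := by
    have := a.isLt
    by_cases h : (a : ℕ) < M
    · have h₁ : M - 1 - (a : ℕ) < M + n := by omega
      have h₂ : (a : ℕ) < M + n := by omega
      simp [deg, bar, h, h₁, h₂]
    · by_cases h' : (a : ℕ) < M + n
      · have h₁ : ¬ 2 * M + 2 * n - 1 - (a : ℕ) < M + n := by omega
        simp [deg, bar, h, h₁, h']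
      · have h₁ : 2 * M + 2 * n - 1 - (a : ℕ) < M + n := by omega
        simp [deg, bar, h, h₁, h']

/-- The height of the weight of an index. -/
def height (M n : ℕ) (a : Fin (M + 2 * n)) : ℤ :=
  if (a : ℕ) < M then M - 1 - 2 * a
  else if (a : ℕ) < M + n then 3 * M + 2 * n - 1 - 2 * a else M + 2 * n - 1 - 2 * a

theorem height_bar (M n : ℕ) (a : Fin (M + 2 * n)) : height M n (bar a) = - height M n a := by
  have := a.isLt
  by_cases h : (a : ℕ) < M
  · have h₁ : M - 1 - (a : ℕ) < M := by omega
    simp only [height, bar, h, h₁, dif_pos, if_true]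
    omega
  · have h₀ : ¬ 2 * M + 2 * n - 1 - (a : ℕ) < M := by omega
    by_cases h' : (a : ℕ) < M + n
    · have h₁ : ¬ 2 * M + 2 * n - 1 - (a : ℕ) < M + n := by omega
      simp only [height, bar, h, h₀, h₁, h', dif_neg, if_false, if_true, not_false_iff]
      omega
    · have h₁ : 2 * M + 2 * n - 1 - (a : ℕ) < M + n := by omega
      simp only [height, bar, h, h₀, h₁, h', dif_neg, if_false, if_true, not_false_iff]
      omega

theorem height_injective (M n : ℕ) : Function.Injective (height M n) := by
  intro a b h
  have := a.isLt
  have := b.isLt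
  ext
  unfold height at h
  split_ifs at h <;> omega

/-- Heights decrease in steps of 2 inside three separate bands: M+2n-1 to M+1 on the first n odd
indices, M-1 to 1-M on the even ones, and -M-1 to 1-M-2n on the last n. -/
theorem positiveRoot_iff {M n : ℕ} {a b : Fin (M + 2 * n)} :
    PositiveRoot M n a b ↔ height M n b < height M n a := by
  have := a.isLt
  have := b.isLt
  unfold PositiveRoot height
  rw [Fin.lt_def]
  split_ifs <;> omega

theorem T_zero (M N : ℕ) (a b : Fin (M + N)) : T M N 0 a b = if a = b then 1 else 0 := by
  unfold T freeT
  split_ifs <;> simp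

theorem neg_one_pow_smul {V : Type*} [AddCommGroup V] [Module ℂ V] (k : ℕ) (v : V) :
    ((-1 : ℂ) ^ k) • v = ((-1 : ℤ) ^ k) • v := by
  rcases neg_one_pow_eq_or ℤ k with h | h <;> rcases neg_one_pow_eq_or ℂ k with h' | h' <;>
  rcases Nat.even_or_odd k with e | e <;> simp [e.neg_one_pow]

theorem coeffRTT_T (M n : ℕ) : CoeffRTT (index M n) (T M (2 * n)) where
  comm_zero a b c d q := by
    rw [T_zero]
    split_ifs with h
    · subst h
      rw [((Even.add_self _).mul_right _).neg_one_pow]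
      simp
    · simp
  zero_comm a b c d q := by
    rw [T_zero]
    split_ifs with h
    · subst h
      rw [((Even.add_self _).mul_left _).neg_one_pow]
      simp
    · simp
  succ a b c d p q := by
    have := RingQuot.mkAlgHom_rel ℂ (YangianRel.rtt (M := M) (N := 2 * n) a b c d p q)
    simp only [freeComm, neg_one_pow_smul, map_sub, map_mul, map_zsmul] at this
    exact this

theorem twist_T (M n p : ℕ) (a b : Fin (M + 2 * n)) :
    twist (index M n) (T M (2 * n)) p a b = S M n p a b := by
  rw [twist, S, ← Finset.Nat.sum_antidiagonal_swap,
    Finset.Nat.sum_antidiagonal_eq_sum_range_succ_mk]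
  refine Finset.sum_congr rfl fun q _ => Finset.sum_congr rfl fun c _ => ?_
  rw [tauT, mul_smul_comm, ← Int.cast_smul_eq_zsmul ℂ]
  congr 1
  simp only [index, theta, Prod.snd_swap]
  push_cast
  split_ifs <;> simp

theorem index_satisfiesReflection (M n : ℕ) : (index M n).SatisfiesReflection (gen M n) := by
  refine OspIndex.SatisfiesReflection.of_injective
    (φ := (TwistedYangian M n).val.toRingHom) Subtype.val_injective ?_
  have := (coeffRTT_T M n).satisfiesReflection
  rwa [show twist (index M n) (T M (2 * n)) = S M n by ext p a b; exact twist_T M n p a b] at this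

theorem gen_zero (M n : ℕ) (a b : Fin (M + 2 * n)) :
    gen M n 0 a b = if a = b then 1 else 0 := by
  refine Subtype.ext ?_
  change S M n 0 a b = _
  rw [← twist_T, twist_zero (T_zero _ _)]
  split_ifs <;> rfl

theorem gen_symm (M n p : ℕ) (a : Fin (M + 2 * n)) :
    (2 : ℤ) • (gen M n (p + 1) a a - ((-1 : ℤ) ^ (p + 1)) • gen M n (p + 1) (bar a) (bar a)) =
      gen M n p (bar a) (bar a) - ((-1 : ℤ) ^ p) • gen M n p (bar a) (bar a) := by
  refine Subtype.ext ?_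
  have := (coeffRTT_T M n).twist_symm p a
  simp only [twist_T] at this
  exact this

/-- The element of the Cartan subalgebra which defines the grading by heights. -/
def grading (M n : ℕ) : TwistedYangian M n := cartan (index M n) (gen M n) (height M n)

theorem grading_comm (M n p : ℕ) (a b : Fin (M + 2 * n)) :
    grading M n * gen M n p a b = gen M n p a b * grading M n +
      (2 * (height M n a - height M n b)) • gen M n p a b := by
  suffices h : grading M n * gen M n p a b - gen M n p a b * grading M n =
      (2 * (height M n a - height M n b)) • gen M n p a b by
    rw [← h]; exact (add_sub_cancel (gen M n p a b * grading M n) (grading M n * gen M n p a b)).symm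
  refine Subtype.ext ?_
  have := (coeffRTT_T M n).cartan_comm_twist (T_zero _ _) (height_bar M n) p a b
  rw [show twist (index M n) (T M (2 * n)) = S M n by ext p a b; exact twist_T M n p a b] at this
  have e : ((grading M n : TwistedYangian M n) : SuperYangian M (2 * n)) =
      cartan (index M n) (S M n) (height M n) := by
    simp only [grading, cartan]
    rw [AddSubmonoidClass.coe_finsetSum]
    rfl
  rw [← e] at this
  exact this

end TwistedSuperYangian

end

/-! ### Representations of the reflection equation: weights and uniqueness. -/

noncomputable section

/-- An action on a complex vector space of the coefficients of a solution of the reflection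
equation, together with a height function on the indices. -/
structure ReflectionRep (I V : Type*) [Fintype I] [DecidableEq I] [AddCommGroup V] [Module ℂ V]
    where
  D : OspIndex I ℤ
  ht : I → ℤ
  ht_bar : ∀ a, ht (D.bar a) = - ht a
  ht_injective : Function.Injective ht
  g : ℕ → I → I → Module.End ℂ V
  reflection : D.SatisfiesReflection g
  zero : ∀ a b, g 0 a b = if a = b then 1 else 0
  symm : ∀ p a, (2 : ℤ) • (g (p + 1) a a - ((-1 : ℤ) ^ (p + 1)) • g (p + 1) (D.bar a) (D.bar a)) =
    g p (D.bar a) (D.bar a) - ((-1 : ℤ) ^ p) • g p (D.bar a) (D.bar a)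
  cartan_mul : ∀ p a b, BiSeries.cartan D g ht * g p a b = g p a b * BiSeries.cartan D g ht +
    (2 * (ht a - ht b)) • g p a b

namespace ReflectionRep

open Module

section Filtration

variable {I : Type*}

/-- The filtration degree of a monomial. -/
def fil (L : List (ℕ × I × I)) : ℕ := (L.map fun l => l.1).sum

@[simp] theorem fil_nil : fil ([] : List (ℕ × I × I)) = 0 := rfl
@[simp] theorem fil_cons (l : ℕ × I × I) (L : List (ℕ × I × I)) :
    fil (l :: L) = l.1 + fil L := by simp [fil]
@[simp] theorem fil_append (L L' : List (ℕ × I × I)) :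
    fil (L ++ L') = fil L + fil L' := by simp [fil]

end Filtration

variable {I V : Type*} [Fintype I] [DecidableEq I] [AddCommGroup V] [Module ℂ V]
  (r : ReflectionRep I V)

/-- The grading operator. -/
abbrev H : End ℂ V := BiSeries.cartan r.D r.g r.ht

/-- The vectors annihilated by all raising operators. -/
def IsSingular (v : V) : Prop := ∀ a b, r.ht b < r.ht a → ∀ p, r.g p a b v = 0

/-- Highest weight vectors. -/
structure IsHighest (v : V) : Prop where
  ne_zero : v ≠ 0
  singular : r.IsSingular v
  eigen : ∀ a p, ∃ c : ℂ, r.g p a a v = c • v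

/-! ### Reordering products -/

/-- The span of the quadratic monomials of filtration degree less than `k` and weight `w`. -/
def quad (k : ℕ) (w : ℤ) : AddSubgroup (End ℂ V) :=
  AddSubgroup.closure {z | ∃ p a b q c d, p + q < k ∧
    (r.ht a - r.ht b) + (r.ht c - r.ht d) = w ∧ z = r.g p a b * r.g q c d}

variable {r} in
theorem mul_mem_quad {k : ℕ} {w : ℤ} {p q : ℕ} {a b c d : I} (h : p + q < k)
    (hw : (r.ht a - r.ht b) + (r.ht c - r.ht d) = w) : r.g p a b * r.g q c d ∈ r.quad k w :=
  AddSubgroup.subset_closure ⟨p, a, b, q, c, d, h, hw, rfl⟩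

theorem reflPerm_mem {k : ℕ} {w : ℤ} {p q : ℕ} {a b c d : I} (h : p + q < k)
    (hw : (r.ht a - r.ht b) + (r.ht c - r.ht d) = w) :
    r.D.reflPerm r.g a b c d p q ∈ r.quad k w :=
  sub_mem (zsmul_mem (mul_mem_quad h (by linarith)) _)
    (zsmul_mem (mul_mem_quad (by omega) (by linarith)) _)

theorem reflContr_mem {k : ℕ} {w : ℤ} {p q : ℕ} {a b c d : I} (h : p + q < k)
    (hw : (r.ht a - r.ht b) + (r.ht c - r.ht d) = w) :
    r.D.reflContr r.g a b c d p q ∈ r.quad k w :=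
  sub_mem (zsmul_mem (mul_mem_quad h (by rw [r.ht_bar, r.ht_bar]; linarith)) _)
    (zsmul_mem (mul_mem_quad (by omega) (by rw [r.ht_bar, r.ht_bar]; linarith)) _)

theorem reflPermContr_mem {k : ℕ} {w : ℤ} {p q : ℕ} {a b c d : I} (h : p + q < k)
    (hw : (r.ht a - r.ht b) + (r.ht c - r.ht d) = w) :
    r.D.reflPermContr r.g a b c d p q ∈ r.quad k w :=
  sub_mem (zsmul_mem (mul_mem_quad h (by rw [r.ht_bar, r.ht_bar]; linarith)) _)
    (zsmul_mem (mul_mem_quad (by omega) (by rw [r.ht_bar, r.ht_bar]; linarith)) _)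

/-- The recursion trades (p + 2, q) for (p, q + 2), keeping the total degree, at the cost of
products of strictly lower degree. The process stops at p = 0 or 1. -/
theorem reflComm_mem (a b c d : I) (p : ℕ) : ∀ q, r.D.reflComm r.g a b c d p q ∈
    r.quad (p + q) ((r.ht a - r.ht b) + (r.ht c - r.ht d)) := by
  induction p using Nat.twoStepInduction with
  | zero =>
    intro q
    rw [r.reflection.zero]
    exact zero_mem _
  | one =>
    intro q
    rw [r.reflection.one]
    exact sub_mem (r.reflPerm_mem (by omega) rfl) (r.reflContr_mem (by omega) rfl)
  | more p ih _ =>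
    intro q
    rw [sub_eq_iff_eq_add.1 (r.reflection.add_two a b c d p q)]
    refine add_mem (add_mem (sub_mem (add_mem ?_ ?_) (sub_mem ?_ ?_)) ?_) ?_
    · exact r.reflPerm_mem (by omega) rfl
    · exact r.reflPerm_mem (by omega) rfl
    · exact r.reflContr_mem (by omega) rfl
    · exact r.reflContr_mem (by omega) rfl
    · exact r.reflPermContr_mem (by omega) rfl
    · rw [show p + 2 + q = p + (q + 2) by ring]
      exact ih _

/-- The associated graded algebra is commutative up to signs, and the corrections keep the weight.
-/
theorem exists_swap (a b c d : I) (p q : ℕ) : ∃ s : ℤ, ∃ z ∈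
    r.quad (p + q) ((r.ht a - r.ht b) + (r.ht c - r.ht d)),
    r.g p a b * r.g q c d = s • (r.g q c d * r.g p a b) + z := by
  have h := r.reflComm_mem a b c d p q
  set e := r.D.deg b * (r.D.deg c + r.D.deg d) with he
  refine ⟨(-1) ^ e * (-1) ^ (r.D.deg a * (r.D.deg c + r.D.deg d)), _,
    zsmul_mem h ((-1 : ℤ) ^ e), ?_⟩
  have he : (-1 : ℤ) ^ e * (-1) ^ e = 1 := by rw [← mul_pow]; simp
  rw [OspIndex.reflComm, smul_sub, smul_smul, smul_smul, he, one_smul]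
  abel

/-! ### Monomials -/

/-- The operator of a monomial. -/
def mon (L : List (ℕ × I × I)) : End ℂ V := (L.map fun l => r.g l.1 l.2.1 l.2.2).prod

/-- The weight of a monomial. -/
def wt (L : List (ℕ × I × I)) : ℤ := (L.map fun l => r.ht l.2.1 - r.ht l.2.2).sum

@[simp] theorem mon_nil : r.mon [] = 1 := rfl
@[simp] theorem mon_cons (l : ℕ × I × I) (L : List (ℕ × I × I)) :
    r.mon (l :: L) = r.g l.1 l.2.1 l.2.2 * r.mon L := by simp [mon]
@[simp] theorem mon_append (L L' : List (ℕ × I × I)) :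
    r.mon (L ++ L') = r.mon L * r.mon L' := by simp [mon]
@[simp] theorem wt_nil : r.wt [] = 0 := rfl
@[simp] theorem wt_cons (l : ℕ × I × I) (L : List (ℕ × I × I)) :
    r.wt (l :: L) = r.ht l.2.1 - r.ht l.2.2 + r.wt L := by simp [wt]
@[simp] theorem wt_append (L L' : List (ℕ × I × I)) :
    r.wt (L ++ L') = r.wt L + r.wt L' := by simp [wt]

variable {r}

/-- The raising factor is moved to the right until it hits v. Each swap leaves monomials of the same
weight and lower filtration degree, covered by `ih`. -/
theorem IsHighest.mon_raising {v : V} (hv : r.IsHighest v) {k : ℕ}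
    (ih : ∀ L, fil L < k → 0 ≤ r.wt L → r.mon L v ∈ ℂ ∙ v) {p : ℕ} {a b : I}
    (hab : r.ht b < r.ht a) (L₂ : List (ℕ × I × I)) :
    ∀ L₁, fil (L₁ ++ (p, a, b) :: L₂) = k → 0 ≤ r.wt (L₁ ++ (p, a, b) :: L₂) →
      r.mon (L₁ ++ (p, a, b) :: L₂) v ∈ ℂ ∙ v := by
  induction L₂ with
  | nil =>
    intro L₁ _ _
    simp [hv.singular a b hab p]
  | cons l L ihL =>
    obtain ⟨q, c, d⟩ := l
    intro L₁ hk hw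
    simp only [fil_append, fil_cons, wt_append, wt_cons] at hk hw
    obtain ⟨s, z, hz, h⟩ := r.exists_swap a b c d p q
    have e : r.mon (L₁ ++ (p, a, b) :: (q, c, d) :: L) =
        s • r.mon ((L₁ ++ [(q, c, d)]) ++ (p, a, b) :: L) + r.mon L₁ * z * r.mon L := by
      simp only [mon_append, mon_cons, mon_nil, mul_one, ← mul_assoc]
      rw [mul_assoc (r.mon L₁), h]
      simp only [mul_add, add_mul, mul_smul_comm, smul_mul_assoc, mul_assoc]
    rw [e, LinearMap.add_apply, LinearMap.smul_apply]
    refine add_mem (zsmul_mem (ihL _ ?_ ?_) _) ?_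
    · simp only [fil_append, fil_cons, fil_nil]
      omega
    · simp only [wt_append, wt_cons, wt_nil]
      omega
    · clear h e
      induction hz using AddSubgroup.closure_induction with
      | mem z hz =>
        obtain ⟨p', a', b', q', c', d', h₁, h₂, rfl⟩ := hz
        have := ih (L₁ ++ (p', a', b') :: (q', c', d') :: L)
          (by simp only [fil_append, fil_cons]; omega)
          (by simp only [wt_append, wt_cons]; omega)
        simpa only [mon_append, mon_cons, mul_assoc] using this
      | zero => simp
      | add z z' _ _ h h' =>
        rw [mul_add, add_mul, LinearMap.add_apply]
        exact add_mem h h'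
      | neg z _ h =>
        rw [mul_neg, neg_mul, LinearMap.neg_apply]
        exact neg_mem h

theorem wt_nonpos {L : List (ℕ × I × I)} (h : ∀ l ∈ L, r.ht l.2.1 ≤ r.ht l.2.2) : r.wt L ≤ 0 := by
  induction L with
  | nil => simp
  | cons l L ih =>
    have h₁ := h l List.mem_cons_self
    have h₂ := ih fun l hl => h l (List.mem_cons_of_mem _ hl)
    rw [wt_cons]
    omega

/-- Induction on the filtration degree. Without a raising factor, the weight is a sum of nonpositive
terms; being nonnegative it forces every factor to be diagonal, and v is an eigenvector of those. -/
theorem IsHighest.mon_mem_span {v : V} (hv : r.IsHighest v) (L : List (ℕ × I × I))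
    (hL : 0 ≤ r.wt L) : r.mon L v ∈ ℂ ∙ v := by
  induction hk : fil L using Nat.strong_induction_on generalizing L with
  | _ k ih =>
  by_cases h : ∃ l ∈ L, r.ht l.2.2 < r.ht l.2.1
  · obtain ⟨⟨p, a, b⟩, hl, hab⟩ := h
    obtain ⟨L₁, L₂, rfl⟩ := List.append_of_mem hl
    exact hv.mon_raising (fun L h₁ h₂ => ih _ h₁ L h₂ rfl) hab L₂ L₁ hk hL
  · push Not at h
    clear ih hk
    have hdiag : ∀ l ∈ L, l.2.1 = l.2.2 := by
      induction L with
      | nil => simp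
      | cons l L ihL =>
        have h₁ : r.wt L ≤ 0 := wt_nonpos fun l hl => h l (List.mem_cons_of_mem _ hl)
        have h₂ := h l List.mem_cons_self
        rw [wt_cons] at hL
        have h₃ : r.wt L = 0 := by omega
        have h₄ : r.ht l.2.1 = r.ht l.2.2 := by omega
        intro l' hl'
        rcases List.mem_cons.1 hl' with rfl | hl'
        · exact r.ht_injective h₄
        · exact ihL h₃.ge (fun l hl => h l (List.mem_cons_of_mem _ hl)) l' hl'
    clear h hL
    induction L with
    | nil => exact Submodule.mem_span_singleton_self v
    | cons l L ihL =>
      obtain ⟨c, hc⟩ := Submodule.mem_span_singleton.1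
        (ihL fun l hl => hdiag l (List.mem_cons_of_mem _ hl))
      obtain ⟨c', hc'⟩ := hv.eigen l.2.1 l.1
      rw [mon_cons, Module.End.mul_apply, ← hc, map_smul, ← hdiag l List.mem_cons_self, hc']
      exact Submodule.smul_mem _ _ (Submodule.smul_mem _ _ (Submodule.mem_span_singleton_self v))

theorem H_mon {v : V} {μ : ℂ} (hv : r.H v = μ • v) (L : List (ℕ × I × I)) :
    r.H (r.mon L v) = (μ + 2 * r.wt L) • r.mon L v := by
  induction L with
  | nil => simp [hv, wt]
  | cons l L ih =>
    rw [mon_cons, ← LinearMap.comp_apply, ← Module.End.mul_eq_comp, ← mul_assoc, r.cartan_mul,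
      wt_cons]
    simp only [add_mul, LinearMap.add_apply, Module.End.mul_apply, smul_mul_assoc, ih, map_smul,
      LinearMap.smul_apply]
    push_cast
    module

theorem IsHighest.H_eigen {v : V} (hv : r.IsHighest v) : ∃ μ : ℂ, r.H v = μ • v := by
  choose c hc using fun a => hv.eigen a 1
  refine ⟨∑ e, (r.ht e * (-1) ^ r.D.deg e : ℤ) * c e, ?_⟩
  simp only [H, BiSeries.cartan, LinearMap.sum_apply, LinearMap.smul_apply, hc, Finset.sum_smul]
  refine Finset.sum_congr rfl fun e _ => ?_
  rw [mul_smul (_ : ℂ), Int.cast_smul_eq_zsmul]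

/-- `v` generates `V`. -/
def Generates (r : ReflectionRep I V) (v : V) : Prop :=
  ∀ W : Submodule ℂ V, v ∈ W → (∀ p a b, ∀ w ∈ W, r.g p a b w ∈ W) → W = ⊤

/-- Monomials applied to v span V; they land in ℂv when the weight is nonnegative, and in a lower
eigenspace of H otherwise. -/
theorem IsHighest.iSup_eigenspace {v : V} (hv : r.IsHighest v) (hg : r.Generates v) {μ : ℂ}
    (hμ : r.H v = μ • v) :
    (ℂ ∙ v) ⊔ ⨆ ν ∈ {ν : ℂ | ∃ d : ℤ, d < 0 ∧ ν = μ + 2 * d}, r.H.eigenspace ν = ⊤ := by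
  have h₁ : Submodule.span ℂ (Set.range fun L => r.mon L v) = ⊤ := by
    refine hg _ (Submodule.subset_span ⟨[], rfl⟩) fun p a b w hw => ?_
    induction hw using Submodule.span_induction with
    | mem w hw =>
      obtain ⟨L, rfl⟩ := hw
      exact Submodule.subset_span ⟨(p, a, b) :: L, by simp⟩
    | zero => simp
    | add x y _ _ hx hy => rw [map_add]; exact add_mem hx hy
    | smul c x _ hx => rw [map_smul]; exact Submodule.smul_mem _ _ hx
  rw [eq_top_iff, ← h₁, Submodule.span_le]
  rintro _ ⟨L, rfl⟩
  by_cases hL : 0 ≤ r.wt L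
  · exact Submodule.mem_sup_left (hv.mon_mem_span L hL)
  · refine Submodule.mem_sup_right (Submodule.mem_iSup_of_mem (μ + 2 * r.wt L)
      (Submodule.mem_iSup_of_mem ⟨_, not_le.1 hL, rfl⟩ ?_))
    exact Module.End.mem_eigenspace_iff.2 (H_mon hμ L)

theorem IsHighest.exists_weight {v w : V} (hv : r.IsHighest v) (hg : r.Generates v) {μ ν : ℂ}
    (hμ : r.H v = μ • v) (hw : w ≠ 0) (hν : r.H w = ν • w) :
    ∃ d : ℤ, d ≤ 0 ∧ ν = μ + 2 * d := by
  by_contra h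
  have hd := (Module.End.eigenspaces_iSupIndep r.H).disjoint_biSup (x := ν)
    (y := {ν : ℂ | ∃ d : ℤ, d ≤ 0 ∧ ν = μ + 2 * d}) h
  refine hw (Submodule.disjoint_def.1 hd w (Module.End.mem_eigenspace_iff.2 hν) ?_)
  suffices h : (⊤ : Submodule ℂ V) ≤ _ from h Submodule.mem_top
  rw [← hv.iSup_eigenspace hg hμ, sup_le_iff, Submodule.span_singleton_le_iff_mem]
  refine ⟨Submodule.mem_iSup_of_mem μ (Submodule.mem_iSup_of_mem ⟨0, le_rfl, by simp⟩
    (Module.End.mem_eigenspace_iff.2 hμ)), ?_⟩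
  exact biSup_mono fun ν ⟨d, hd, e⟩ => ⟨d, hd.le, e⟩

/-- The part of w in lower eigenspaces is itself a μ-eigenvector, so it vanishes by independence of
eigenspaces. -/
theorem IsHighest.mem_span_of_weight_eq {v w : V} (hv : r.IsHighest v) (hg : r.Generates v)
    {μ : ℂ} (hμ : r.H v = μ • v) (hw : r.H w = μ • w) : w ∈ ℂ ∙ v := by
  have h : w ∈ (⊤ : Submodule ℂ V) := Submodule.mem_top
  rw [← hv.iSup_eigenspace hg hμ] at h
  obtain ⟨x, hx, y, hy, rfl⟩ := Submodule.mem_sup.1 h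
  obtain ⟨c, rfl⟩ := Submodule.mem_span_singleton.1 hx
  have hμ' : μ ∉ {ν : ℂ | ∃ d : ℤ, d < 0 ∧ ν = μ + 2 * d} := by
    rintro ⟨d, hd, e⟩
    have : (d : ℂ) = 0 := by linear_combination (-1 / 2 : ℂ) * e
    exact hd.ne (Int.cast_eq_zero.1 this)
  have hd := (Module.End.eigenspaces_iSupIndep r.H).disjoint_biSup hμ'
  have hy' : r.H y = μ • y := by
    rw [map_add, map_smul, hμ, smul_add, smul_comm c] at hw
    exact add_left_cancel hw
  rw [Submodule.disjoint_def.1 hd y (Module.End.mem_eigenspace_iff.2 hy') hy, add_zero]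
  exact hx

theorem IsHighest.mem_span {v w : V} (hv : r.IsHighest v) (hg : r.Generates v)
    (hw : r.IsHighest w) (hg' : r.Generates w) : w ∈ ℂ ∙ v := by
  obtain ⟨μ, hμ⟩ := hv.H_eigen
  obtain ⟨ν, hν⟩ := hw.H_eigen
  obtain ⟨d, hd, e⟩ := hv.exists_weight hg hμ hw.ne_zero hν
  obtain ⟨d', hd', e'⟩ := hw.exists_weight hg' hν hv.ne_zero hμ
  -- Each weight is at most the other, so both differences are zero.
  have : ((d + d' : ℤ) : ℂ) = 0 := by push_cast; linear_combination (-1 / 2 : ℂ) * (e + e')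
  have : d = 0 := by have := Int.cast_eq_zero.1 this; omega
  subst this
  refine hv.mem_span_of_weight_eq hg hμ ?_
  rw [hν, e]
  simp

end ReflectionRep

end

/-! ### Existence of highest weight vectors. -/

noncomputable section

/-- To be applied to commutators of diagonal generators on a singular vector: there the right side
of the reflection equation reduces to multiples of the same commutators in lower degree. -/
theorem eq_zero_of_reflection_recursion {V : Type*} [AddCommGroup V] (F : ℕ → ℕ → V) (α β γ : ℤ)
    (h₀ : ∀ q, F 0 q = 0) (h₁ : ∀ q, F 1 q = α • F 0 q - β • F 0 q)
    (h₂ : ∀ p q, F (p + 2) q - F p (q + 2) = α • F p (q + 1) + α • F (p + 1) q -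
      (β • F (p + 1) q - β • F p (q + 1)) + γ • F p q) (p q : ℕ) : F p q = 0 := by
  induction hN : p + q using Nat.strong_induction_on generalizing p q with
  | _ N ih =>
  induction p using Nat.twoStepInduction generalizing q with
  | zero => exact h₀ q
  | one => rw [h₁, h₀]; simp
  | more p ihp _ =>
    rw [sub_eq_iff_eq_add.1 (h₂ p q), ihp (q + 2) (by omega), ih _ (by omega) p (q + 1) rfl,
      ih _ (by omega) (p + 1) q rfl, ih _ (by omega) p q rfl]
    simp

/-- Operators which preserve a nonzero finite-dimensional subspace and commute on it have a common
eigenvector in it. -/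
theorem exists_common_eigenvector {V ι : Type*} [AddCommGroup V] [Module ℂ V]
    [FiniteDimensional ℂ V] (f : ι → Module.End ℂ V) (E : Submodule ℂ V) (hE : E ≠ ⊥)
    (hf : ∀ i, ∀ v ∈ E, f i v ∈ E) (hc : ∀ i j, ∀ v ∈ E, f i (f j v) = f j (f i v)) :
    ∃ v ∈ E, v ≠ 0 ∧ ∀ i, ∃ c : ℂ, f i v = c • v := by
  induction hN : Module.finrank ℂ E using Nat.strong_induction_on generalizing E with
  | _ N ih =>
  by_cases h : ∀ i, ∃ c : ℂ, ∀ v ∈ E, f i v = c • v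
  · obtain ⟨v, hv, h₀⟩ := E.ne_bot_iff.1 hE
    exact ⟨v, hv, h₀, fun i => (h i).imp fun c hc => hc v hv⟩
  · push Not at h
    obtain ⟨i, hi⟩ := h
    have : Nontrivial E := (Submodule.nontrivial_iff_ne_bot).2 hE
    obtain ⟨c, hev⟩ := Module.End.exists_eigenvalue ((f i).restrict (hf i))
    obtain ⟨w, hw⟩ := hev.exists_hasEigenvector
    have hw' : f i w = c • (w : V) := by
      simpa using congrArg Subtype.val hw.apply_eq_smul
    obtain ⟨u, hu, hne⟩ := hi c
    -- As `f i` is not scalar on E, its eigenspace is smaller; commutation keeps it stable under the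
    -- other operators.
    have hlt : E ⊓ (f i).eigenspace c < E := by
      refine lt_of_le_of_ne inf_le_left fun h => hne ?_
      rw [← h] at hu
      exact Module.End.mem_eigenspace_iff.1 hu.2
    obtain ⟨v, hv, h⟩ := ih _ (hN ▸ Submodule.finrank_lt_finrank_of_lt hlt)
      (E ⊓ (f i).eigenspace c)
      ((Submodule.ne_bot_iff _).2 ⟨w, ⟨w.2, Module.End.mem_eigenspace_iff.2 hw'⟩,
        fun h => hw.2 (Subtype.ext h)⟩)
      (fun j v hv => ⟨hf j v hv.1, Module.End.mem_eigenspace_iff.2 (by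
        rw [hc i j v hv.1, Module.End.mem_eigenspace_iff.1 hv.2, map_smul])⟩)
      (fun j k v hv => hc j k v hv.1) rfl
    exact ⟨v, hv.1, h⟩

namespace ReflectionRep

open Module

variable {I V : Type*} [Fintype I] [DecidableEq I] [AddCommGroup V] [Module ℂ V]
  {r : ReflectionRep I V}

theorem reflComm_diag (a c : I) (p q : ℕ) (v : V) : r.D.reflComm r.g a a c c p q v =
    r.g p a a (r.g q c c v) - r.g q c c (r.g p a a v) := by
  rw [OspIndex.reflComm, ((Even.add_self (r.D.deg c)).mul_left _).neg_one_pow]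
  simp

/-- Every term on the right of the reflection equation ends in an operator (a, c), (bar a, c) or
(bar c, a). All are raising because ht c < ht a ≤ 0. -/
theorem IsSingular.commute_of_lt {v : V} (hv : r.IsSingular v) {a c : I} (ha : r.ht a ≤ 0)
    (hca : r.ht c < r.ht a) (p q : ℕ) :
    r.g p a a (r.g q c c v) = r.g q c c (r.g p a a v) := by
  rw [← sub_eq_zero, ← reflComm_diag]
  have k₁ : ∀ p, r.g p a c v = 0 := hv a c hca
  have k₂ : ∀ p, r.g p (r.D.bar a) c v = 0 := hv _ _ (by rw [r.ht_bar]; omega)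
  have k₃ : ∀ p, r.g p (r.D.bar c) a v = 0 := hv _ _ (by rw [r.ht_bar]; omega)
  have h₁ : ∀ p q, r.D.reflPerm r.g a a c c p q v = 0 := fun p q => by
    simp [OspIndex.reflPerm, k₁, -zsmul_eq_mul]
  have h₂ : ∀ p q, r.D.reflContr r.g a a c c p q v = 0 := fun p q => by
    simp [OspIndex.reflContr, k₂, k₃, -zsmul_eq_mul]
  have h₃ : ∀ p q, r.D.reflPermContr r.g a a c c p q v = 0 := fun p q => by
    simp [OspIndex.reflPermContr, k₂, -zsmul_eq_mul]
  refine eq_zero_of_reflection_recursion (fun p q => r.D.reflComm r.g a a c c p q v) 0 0 0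
    (fun q => ?_) (fun q => ?_) (fun p q => ?_) p q
  · simp [r.reflection.zero]
  · simp [r.reflection.one, h₁, h₂]
  · have := congrArg (fun z => z v) (r.reflection.add_two a a c c p q)
    simpa [h₁, h₂, h₃] using this

/-- The permutation terms are multiples of the commutator. The transposed ones end in the raising
operator (bar a, a) if ht a < 0; if ht a = 0 then bar a = a, and they are multiples of the
commutator too. -/
theorem IsSingular.commute_self {v : V} (hv : r.IsSingular v) {a : I} (ha : r.ht a ≤ 0)
    (p q : ℕ) : r.g p a a (r.g q a a v) = r.g q a a (r.g p a a v) := by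
  rw [← sub_eq_zero, ← reflComm_diag]
  have h₁ : ∀ p q, r.D.reflPerm r.g a a a a p q =
      ((-1 : ℤ) ^ (r.D.deg a * r.D.deg a + r.D.deg a * (r.D.deg a + r.D.deg a))) •
        r.D.reflComm r.g a a a a p q := fun p q => by
    rw [OspIndex.reflPerm, OspIndex.reflComm,
      ((Even.add_self (r.D.deg a)).mul_left _).neg_one_pow, one_smul, one_smul, smul_sub]
  have h₂ : ∃ β : ℤ, ∀ p q, r.D.reflContr r.g a a a a p q v =
      β • r.D.reflComm r.g a a a a p q v := by
    rcases ha.lt_or_eq with ha | ha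
    · have k : ∀ p, r.g p (r.D.bar a) a v = 0 := hv _ _ (by rw [r.ht_bar]; omega)
      exact ⟨0, fun p q => by simp [OspIndex.reflContr, k, -zsmul_eq_mul]⟩
    · have k : r.D.bar a = a := r.ht_injective (by rw [r.ht_bar]; omega)
      refine ⟨(-1) ^ (r.D.deg a + r.D.deg a * (r.D.deg a + r.D.deg a)) * r.D.θ a * r.D.θ a,
        fun p q => ?_⟩
      rw [OspIndex.reflContr, OspIndex.reflComm,
        ((Even.add_self (r.D.deg a)).mul_left _).neg_one_pow, one_smul, one_smul, k,
        add_comm (r.D.deg a * (r.D.deg a + r.D.deg a)), ← smul_sub]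
      rfl
  have h₃ : ∃ γ : ℤ, ∀ p q, r.D.reflPermContr r.g a a a a p q v =
      γ • r.D.reflComm r.g a a a a p q v := by
    rcases ha.lt_or_eq with ha | ha
    · have k : ∀ p, r.g p (r.D.bar a) a v = 0 := hv _ _ (by rw [r.ht_bar]; omega)
      exact ⟨0, fun p q => by simp [OspIndex.reflPermContr, k, -zsmul_eq_mul]⟩
    · have k : r.D.bar a = a := r.ht_injective (by rw [r.ht_bar]; omega)
      refine ⟨(-1) ^ (r.D.deg a * r.D.deg a + (r.D.deg a +
        r.D.deg a * (r.D.deg a + r.D.deg a))) * r.D.θ a * r.D.θ a, fun p q => ?_⟩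
      rw [OspIndex.reflPermContr, OspIndex.reflComm,
        ((Even.add_self (r.D.deg a)).mul_left _).neg_one_pow, one_smul, one_smul, k,
        add_comm (r.D.deg a * (r.D.deg a + r.D.deg a)), ← smul_sub]
      rfl
  obtain ⟨β, h₂⟩ := h₂
  obtain ⟨γ, h₃⟩ := h₃
  refine eq_zero_of_reflection_recursion (fun p q => r.D.reflComm r.g a a a a p q v)
    ((-1 : ℤ) ^ (r.D.deg a * r.D.deg a + r.D.deg a * (r.D.deg a + r.D.deg a))) β γ
    (fun q => ?_) (fun q => ?_) (fun p q => ?_) p q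
  · simp [r.reflection.zero]
  · have := congrArg (fun z => z v) (r.reflection.one a a a a q)
    simp only [LinearMap.sub_apply, h₁, h₂, LinearMap.smul_apply] at this
    exact this
  · have := congrArg (fun z => z v) (r.reflection.add_two a a a a p q)
    simp only [LinearMap.sub_apply, LinearMap.add_apply, h₁, h₂, h₃, LinearMap.smul_apply] at this
    exact this

theorem IsSingular.commute {v : V} (hv : r.IsSingular v) {a c : I} (ha : r.ht a ≤ 0)
    (hc : r.ht c ≤ 0) (p q : ℕ) : r.g p a a (r.g q c c v) = r.g q c c (r.g p a a v) := by
  rcases lt_trichotomy (r.ht c) (r.ht a) with h | h | h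
  · exact hv.commute_of_lt ha h p q
  · obtain rfl := r.ht_injective h
    exact hv.commute_self ha p q
  · exact (hv.commute_of_lt hc h q p).symm

/-- For positive height, the symmetry relation expresses the operator through those of bar a, which
has negative height. -/
theorem eigen_of_nonpos {v : V} (h : ∀ a, r.ht a ≤ 0 → ∀ p, ∃ c : ℂ, r.g p a a v = c • v) (a : I)
    (p : ℕ) : ∃ c : ℂ, r.g p a a v = c • v := by
  rcases le_or_gt (r.ht a) 0 with ha | ha
  · exact h a ha p
  · have hb : r.ht (r.D.bar a) ≤ 0 := by rw [r.ht_bar]; omega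
    cases p with
    | zero => exact ⟨1, by simp [r.zero]⟩
    | succ p =>
      obtain ⟨c, hc⟩ := h _ hb (p + 1)
      obtain ⟨c', hc'⟩ := h _ hb p
      have := congrArg (fun z => z v) (r.symm p a)
      simp only [LinearMap.sub_apply, LinearMap.smul_apply, hc, hc'] at this
      refine ⟨(((-1 : ℤ) ^ (p + 1) : ℤ) : ℂ) * c + 1 / 2 * (c' - ((-1 : ℤ) ^ p : ℤ) * c'), ?_⟩
      linear_combination (norm := module) (1 / 2 : ℂ) • this

theorem exists_isHighest [FiniteDimensional ℂ V] [Nontrivial V] (r : ReflectionRep I V) :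
    ∃ v, r.IsHighest v := by
  -- Eigenvalues may be complex, but raising shifts them by positive integers, so maximality of the
  -- real part suffices.
  obtain ⟨μ, hμ, hmax⟩ := Set.exists_max_image _ Complex.re
    (Module.End.finite_hasEigenvalue r.H) (Module.End.exists_eigenvalue r.H)
  have hmap : ∀ a b p, ∀ v ∈ r.H.eigenspace μ,
      r.g p a b v ∈ r.H.eigenspace (μ + (2 * (r.ht a - r.ht b) : ℤ)) := by
    intro a b p v hv
    rw [Module.End.mem_eigenspace_iff] at hv ⊢
    rw [← Module.End.mul_apply, r.cartan_mul]
    simp only [LinearMap.add_apply, Module.End.mul_apply, LinearMap.smul_apply, hv, map_smul,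
      add_smul, Int.cast_smul_eq_zsmul]
  have hsing : ∀ v ∈ r.H.eigenspace μ, r.IsSingular v := by
    intro v hv a b hab p
    by_contra h
    have := hmax _ (Module.End.hasEigenvalue_of_hasEigenvector ⟨hmap a b p v hv, h⟩)
    rw [Complex.add_re, Complex.intCast_re] at this
    have : ((2 * (r.ht a - r.ht b) : ℤ) : ℝ) ≤ 0 := by linarith
    have := Int.cast_nonpos.1 this
    omega
  obtain ⟨v, hv, h₀, h⟩ := exists_common_eigenvector
    (fun i : ℕ × {a // r.ht a ≤ 0} => r.g i.1 i.2 i.2) (r.H.eigenspace μ) hμ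
    (fun i v hv => by simpa using hmap i.2 i.2 i.1 v hv)
    (fun i j v hv => (hsing v hv).commute i.2.2 j.2.2 _ _)
  exact ⟨v, h₀, hsing v hv, eigen_of_nonpos fun a ha p => h (p, ⟨a, ha⟩)⟩

/-- The components of a highest weight vector with respect to a decomposition permuted by the
operators are highest weight vectors or zero. -/
theorem IsHighest.component {v w : V} (h : r.IsHighest (v + w)) {e : I → I → ZMod 2}
    (he : ∀ a, e a a = 0) {𝒱 : ZMod 2 → Submodule ℂ V} (hi : iSupIndep 𝒱)
    (hg : ∀ p a b i, ∀ v ∈ 𝒱 i, r.g p a b v ∈ 𝒱 (i + e a b)) {i j : ZMod 2} (hij : i ≠ j)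
    (hv : v ∈ 𝒱 i) (hw : w ∈ 𝒱 j) (h₀ : v ≠ 0) : r.IsHighest v := by
  -- An operator of parity k moves both components by k, so they stay in different summands and each
  -- equation holds componentwise.
  have key : ∀ k, ∀ x ∈ 𝒱 (i + k), ∀ y ∈ 𝒱 (j + k), x + y = 0 → x = 0 := by
    intro k x hx y hy hxy
    refine Submodule.disjoint_def.1 (hi.pairwiseDisjoint fun h => hij (add_right_cancel h)) x hx ?_
    rw [eq_neg_of_add_eq_zero_left hxy]
    exact neg_mem hy
  refine ⟨h₀, fun a b hab p => ?_, fun a p => ?_⟩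
  · refine key (e a b) _ (hg p a b i v hv) _ (hg p a b j w hw) ?_
    rw [← map_add, h.singular a b hab p]
  · obtain ⟨c, hc⟩ := h.eigen a p
    refine ⟨c, sub_eq_zero.1 (key 0 _ (sub_mem ?_ ?_) (r.g p a a w - c • w) (sub_mem ?_ ?_) ?_)⟩
    · rw [← he a]; exact hg p a a i v hv
    · rw [add_zero]; exact Submodule.smul_mem _ _ hv
    · rw [← he a]; exact hg p a a j w hw
    · rw [add_zero]; exact Submodule.smul_mem _ _ hw
    · rw [map_add, smul_add] at hc
      linear_combination (norm := module) hc

end ReflectionRep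

end

/-! ### Modules over the twisted super Yangian. -/

noncomputable section

namespace TwistedSuperYangian

section Action

variable (M n : ℕ) (V : Type*) [AddCommGroup V] [Module ℂ V] [Module (TwistedYangian M n) V]
  [IsScalarTower ℂ (TwistedYangian M n) V]

/-- The action of `Y(M|2n)^+` on a module. -/
def action : TwistedYangian M n →+* Module.End ℂ V :=
  (Algebra.lsmul ℂ ℂ V : TwistedYangian M n →ₐ[ℂ] Module.End ℂ V).toRingHom

theorem action_zsmul (k : ℤ) (x : TwistedYangian M n) : action M n V (k • x) = k • action M n V x := by
  rw [← map_zsmul]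

theorem action_sub (x y : TwistedYangian M n) :
    action M n V (x - y) = action M n V x - action M n V y := by
  rw [← map_sub]

theorem action_grading : action M n V (grading M n) =
    BiSeries.cartan (index M n) (fun p a b => action M n V (gen M n p a b)) (height M n) := by
  simp only [grading, BiSeries.cartan]
  rw [map_sum]
  exact Finset.sum_congr rfl fun e _ => map_zsmul _ _ _

/-- A module over `Y(M|2n)^+` as a representation of the reflection equation. -/
def reflectionRep : ReflectionRep (Fin (M + 2 * n)) V where
  D := index M n
  ht := height M n
  ht_bar := height_bar M n
  ht_injective := height_injective M n
  g p a b := action M n V (gen M n p a b)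
  reflection := (index_satisfiesReflection M n).map (action M n V)
  zero a b := by
    rw [gen_zero]
    split_ifs
    · exact map_one _
    · exact map_zero _
  symm p a := by
    have := congrArg (action M n V) (gen_symm M n p a)
    rw [action_zsmul, action_sub, action_zsmul, action_sub, action_zsmul] at this
    exact this
  cartan_mul p a b := by
    have := congrArg (action M n V) (grading_comm M n p a b)
    rw [map_mul, map_add, map_mul, action_zsmul, action_grading] at this
    exact this

variable {M n V}

/-- The constant term 1 of μ_a is automatic, because S^{aa}_{(0)} = 1 and v ≠ 0. -/
theorem isHighestWeightVector_iff {v : V} :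
    IsHighestWeightVector M n v ↔ (reflectionRep M n V).IsHighest v := by
  constructor
  · rintro ⟨h₀, h₁, μ, -, hμ⟩
    exact ⟨h₀, fun a b hab p => h₁ a b (positiveRoot_iff.2 hab) p, fun a p => ⟨_, hμ a p⟩⟩
  · rintro ⟨h₀, h₁, h₂⟩
    choose c hc using h₂
    refine ⟨h₀, fun a b hab p => h₁ a b (positiveRoot_iff.1 hab) p,
      fun a => PowerSeries.mk (c a), fun a => ?_, fun a p => ?_⟩
    · have h : gen M n 0 a a • v = c a 0 • v := hc a 0
      rw [gen_zero, if_pos rfl, one_smul] at h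
      rw [← PowerSeries.coeff_zero_eq_constantCoeff_apply, PowerSeries.coeff_mk]
      have : (c a 0 - 1) • v = 0 := by rw [sub_smul, ← h, one_smul, sub_self]
      exact sub_eq_zero.1 ((smul_eq_zero.1 this).resolve_right h₀)
    · rw [PowerSeries.coeff_mk]
      exact hc a p

theorem smul_mem_of_gen {W : Submodule ℂ V} (hW : ∀ p a b, ∀ w ∈ W, gen M n p a b • w ∈ W)
    (x : TwistedYangian M n) {w : V} (hw : w ∈ W) : x • w ∈ W := by
  obtain ⟨x, hx⟩ := x
  induction hx using Algebra.adjoin_induction generalizing w with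
  | mem x hx =>
    obtain ⟨p, a, b, rfl⟩ := hx
    exact hW p a b w hw
  | algebraMap c =>
    have : (algebraMap ℂ (TwistedYangian M n) c) • w ∈ W := by
      rw [algebraMap_smul]
      exact W.smul_mem c hw
    exact this
  | add x y hx hy ihx ihy =>
    have := W.add_mem (ihx hw) (ihy hw)
    rw [← add_smul] at this
    exact this
  | mul x y hx hy ihx ihy =>
    have := ihx (ihy hw)
    rw [← mul_smul] at this
    exact this

theorem generates_of_span_eq_top {v : V} (hv : Submodule.span (TwistedYangian M n) {v} = ⊤) :
    (reflectionRep M n V).Generates v := by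
  intro W hvW hW
  rw [eq_top_iff]
  intro w _
  have hw : w ∈ Submodule.span (TwistedYangian M n) {v} := hv ▸ Submodule.mem_top
  obtain ⟨x, rfl⟩ := Submodule.mem_span_singleton.1 hw
  exact smul_mem_of_gen hW x hvW

theorem deg_add_self_cast (a : Fin (M + 2 * n)) : ((deg M a + deg M a : ℕ) : ZMod 2) = 0 := by
  rw [Nat.cast_add]
  exact CharTwo.add_self_eq_zero _

/-- The submodule generated by v is graded: the sum of its homogeneous parts contains v and is
stable under the generators. -/
theorem span_eq_top_of_homogeneous {𝒱 : ZMod 2 → Submodule ℂ V} (h𝒱 : IsSuperGrading M n V 𝒱)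
    (hV : IsGradedIrreducible M n V 𝒱) {v : V} (h₀ : v ≠ 0) {i : ZMod 2} (hv : v ∈ 𝒱 i) :
    Submodule.span (TwistedYangian M n) {v} = ⊤ := by
  set W := Submodule.span (TwistedYangian M n) {v} with hW
  have hvW : v ∈ W := Submodule.mem_span_singleton_self v
  let W' : Submodule ℂ V := W.restrictScalars ℂ
  have hG : ∀ p a b, ∀ w ∈ (W' ⊓ 𝒱 0) ⊔ (W' ⊓ 𝒱 1),
      gen M n p a b • w ∈ (W' ⊓ 𝒱 0) ⊔ (W' ⊓ 𝒱 1) := by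
    intro p a b w hw
    have key : ∀ j, ∀ x ∈ W' ⊓ 𝒱 j, gen M n p a b • x ∈ (W' ⊓ 𝒱 0) ⊔ (W' ⊓ 𝒱 1) := by
      intro j x hx
      have h₁ : gen M n p a b • x ∈ W' := W.smul_mem _ hx.1
      have h₂ := h𝒱.gen_smul_mem p a b j x hx.2
      generalize j + ((deg M a + deg M b : ℕ) : ZMod 2) = k at h₂
      fin_cases k
      · exact Submodule.mem_sup_left ⟨h₁, h₂⟩
      · exact Submodule.mem_sup_right ⟨h₁, h₂⟩
    obtain ⟨x, hx, y, hy, rfl⟩ := Submodule.mem_sup.1 hw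
    rw [smul_add]
    exact add_mem (key 0 x hx) (key 1 y hy)
  refine (hV.2 W fun w hw => ?_).resolve_left fun h => h₀ ?_
  · obtain ⟨x, rfl⟩ := Submodule.mem_span_singleton.1 hw
    have hvG : v ∈ (W' ⊓ 𝒱 0) ⊔ (W' ⊓ 𝒱 1) := by
      fin_cases i
      · exact Submodule.mem_sup_left ⟨hvW, hv⟩
      · exact Submodule.mem_sup_right ⟨hvW, hv⟩
    obtain ⟨w₀, h₀, w₁, h₁, h⟩ := Submodule.mem_sup.1 (smul_mem_of_gen hG x hvG)
    exact ⟨w₀, h₀.1, w₁, h₁.1, h₀.2, h₁.2, h.symm⟩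
  · rw [h] at hvW
    exact hvW

/-- In the graded case v must be shown homogeneous: two nonzero components would both be generating
highest vectors, hence proportional, though they lie in independent subspaces. -/
theorem IsHighestWeightVector.span_eq_top (hV : IsIrreducibleRep M n V) {v : V}
    (hv : IsHighestWeightVector M n v) : Submodule.span (TwistedYangian M n) {v} = ⊤ := by
  rcases hV with hV | ⟨𝒱, h𝒱, hV⟩
  · exact IsSimpleModule.span_singleton_eq_top (TwistedYangian M n) hv.1
  · have h01 : (0 : ZMod 2) ≠ 1 := by decide
    have hi := h𝒱.isInternal.submodule_iSupIndep
    have htop : v ∈ 𝒱 0 ⊔ 𝒱 1 := by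
      have h : v ∈ ⨆ i, 𝒱 i := h𝒱.isInternal.submodule_iSup_eq_top ▸ Submodule.mem_top
      refine (iSup_le fun i => ?_ : (⨆ i, 𝒱 i) ≤ 𝒱 0 ⊔ 𝒱 1) h
      fin_cases i
      · exact le_sup_left
      · exact le_sup_right
    obtain ⟨x, hx, y, hy, rfl⟩ := Submodule.mem_sup.1 htop
    rw [isHighestWeightVector_iff] at hv
    by_cases hx₀ : x = 0
    · subst hx₀
      exact span_eq_top_of_homogeneous h𝒱 hV hv.ne_zero (i := 1) (by rwa [zero_add])
    by_cases hy₀ : y = 0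
    · subst hy₀
      exact span_eq_top_of_homogeneous h𝒱 hV hv.ne_zero (i := 0) (by rwa [add_zero])
    exfalso
    have hgx := generates_of_span_eq_top (span_eq_top_of_homogeneous h𝒱 hV hx₀ hx)
    have hgy := generates_of_span_eq_top (span_eq_top_of_homogeneous h𝒱 hV hy₀ hy)
    have hX := hv.component (e := fun a b => ((deg M a + deg M b : ℕ) : ZMod 2))
      deg_add_self_cast hi (fun p a b i v => h𝒱.gen_smul_mem p a b i v) h01 hx hy hx₀
    rw [add_comm x y] at hv
    have hY := hv.component (e := fun a b => ((deg M a + deg M b : ℕ) : ZMod 2))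
      deg_add_self_cast hi (fun p a b i v => h𝒱.gen_smul_mem p a b i v) h01.symm hy hx hy₀
    obtain ⟨c, hc⟩ := Submodule.mem_span_singleton.1 (hX.mem_span hgx hY hgy)
    refine hy₀ (Submodule.disjoint_def.1 (hi.pairwiseDisjoint h01) y ?_ hy)
    rw [← hc]
    exact Submodule.smul_mem _ _ hx

end Action

end TwistedSuperYangian

end

theorem mainTheorem6 (M n : ℕ) (V : Type*) [AddCommGroup V] [Module ℂ V]
    [Module (TwistedSuperYangian.TwistedYangian M n) V]
    [IsScalarTower ℂ (TwistedSuperYangian.TwistedYangian M n) V]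
    [FiniteDimensional ℂ V]
    (hV : TwistedSuperYangian.IsIrreducibleRep M n V) :
    TwistedSuperYangian.IsHighestWeightRep M n V ∧
    ∀ v w : V, TwistedSuperYangian.IsHighestWeightVector M n v →
      TwistedSuperYangian.IsHighestWeightVector M n w → ∃ c : ℂ, w = c • v := by
  have : Nontrivial V := by
    rcases hV with hV | ⟨𝒱, -, hV⟩
    · exact IsSimpleModule.nontrivial (TwistedSuperYangian.TwistedYangian M n) V
    · exact hV.1
  refine ⟨?_, fun v w hv hw => ?_⟩
  · obtain ⟨v, hv⟩ := (TwistedSuperYangian.reflectionRep M n V).exists_isHighest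
    rw [← TwistedSuperYangian.isHighestWeightVector_iff] at hv
    exact ⟨v, hv, hv.span_eq_top hV⟩
  · have hv' := TwistedSuperYangian.generates_of_span_eq_top (hv.span_eq_top hV)
    have hw' := TwistedSuperYangian.generates_of_span_eq_top (hw.span_eq_top hV)
    rw [TwistedSuperYangian.isHighestWeightVector_iff] at hv hw
    obtain ⟨c, hc⟩ := Submodule.mem_span_singleton.1 (hv.mem_span hv' hw hw')
    exact ⟨c, hc.symm⟩
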